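/- There is an absolute constant $C>0$ such that the following holds for every integer $\gamma\ge 1$ and every finite simple undirected unweighted graph $G=(V,E)$ with $n$ vertices and girth at least $2\gamma+1$ (the girth of a forest is $\infty$). Here an *$f(d)$-spanner* of $G$ is a subgraph $H$ of $G$ on the vertex set $V$ with $\operatorname{dist}_H(u,v)\le f(\operatorname{dist}_G(u,v))$ for all $u,v$ at finite distance in $G$. An *$f(d)$-emulator* of $G$ is a finite graph $H$ with positive edge weights and vertex set $V'\supseteq V$ such that $\operatorname{dist}_G(u,v)\le\operatorname{dist}_H(u,v)$ for all $u,v\in V$, and $\operatorname{dist}_H(u,v)\le f(\operatorname{dist}_G(u,v))$ for all $u,v\in V$ at finite distance in $G$. The *size* is the number of edges of $H$. 1. $G$ has an additive $4\gamma$-emulator (that is, $f(d)=d+4\gamma$) of size at most $C\,n^{1+\frac1{2\gamma+1}}$, and an additive $6\gamma$-spanner ($f(d)=d+6\gamma$) of size at most $C\,n^{1+\frac1{2\gamma+1}}$. 2. For every integer $k\ge 2$, $G$ has an emulator with stretch function $f(d)=d+C\gamma\,(k\,d^{1-1/k}+3^k)$ and size at most $C\,k\,n^{1+\frac{1}{(\gamma+1)2^k-1}}$.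 (In particular $f(d)=d+O(\gamma k d^{1-1/k})$ for all $d\ge 3^k$, with an absolute constant.) 3. For every integer $k\ge 2$ and every real $0<\varepsilon\le 1$, $G$ has a spanner with stretch function $f(d)=(1+\varepsilon)d+(C\gamma k/\varepsilon)^{k-1}$ and size at most $C\,(\gamma k/\varepsilon)^{h}\,k\,n^{1+\frac{1}{(\gamma+1)2^k-1}}$, where $$h=\frac{3\cdot 2^{k-1}-(k+2)}{(\gamma+1)2^k-1}<\frac{3}{2(\gamma+1)}.$$ -/

import Mathlib

open scoped ENNReal NNReal

universe u

namespace GirthCompression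

/-- The total weight of a walk in a graph whose edges carry nonnegative weights. -/
noncomputable def walkWeight {W : Type u} {H : SimpleGraph W} (w : Sym2 W → ℝ≥0) {x y : W}
    (p : H.Walk x y) : ℝ≥0 :=
  (p.edges.map w).sum

/-- The distance in a weighted graph: the infimum of the weights of the walks joining two vertices
(`∞` if there is none). -/
noncomputable def weightedDist {W : Type u} (H : SimpleGraph W) (w : Sym2 W → ℝ≥0) (x y : W) :
    ℝ≥0∞ :=
  ⨅ p : H.Walk x y, (walkWeight w p : ℝ≥0∞)

/-- An `f(d)`-emulator of `G`: a finite graph `H` with positive edge weights whose vertex set `W`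
contains a copy of `V` (the other vertices are Steiner points). It never contracts distances
between vertices of `G`, and pairs at finite distance `d` in `G` are at distance at most `f d`
in `H`. -/
structure Emulator {V : Type u} (G : SimpleGraph V) (f : ℕ → ℝ) where
  W : Type u
  finite : Finite W
  ι : V ↪ W
  H : SimpleGraph W
  w : Sym2 W → ℝ≥0
  w_pos : ∀ e ∈ H.edgeSet, 0 < w e
  dist_le : ∀ u v : V, (G.edist u v : ℝ≥0∞) ≤ weightedDist H w (ι u) (ι v)
  le_stretch : ∀ u v : V, G.Reachable u v →
    weightedDist H w (ι u) (ι v) ≤ ENNReal.ofReal (f (G.dist u v))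

/-- The size of an emulator is its number of edges. -/
noncomputable def Emulator.size {V : Type u} {G : SimpleGraph V} {f : ℕ → ℝ}
    (E : Emulator G f) : ℕ :=
  E.H.edgeSet.ncard

/-- An `f(d)`-spanner of `G`: a subgraph `H` on the same vertex set in which every pair at finite
distance `d` in `G` is at distance at most `f d`. -/
structure Spanner {V : Type u} (G : SimpleGraph V) (f : ℕ → ℝ) where
  H : SimpleGraph V
  le : H ≤ G
  reachable : ∀ u v : V, G.Reachable u v → H.Reachable u v
  le_stretch : ∀ u v : V, G.Reachable u v → (H.dist u v : ℝ) ≤ f (G.dist u v)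

/-- The size of a spanner is its number of edges. -/
noncomputable def Spanner.size {V : Type u} {G : SimpleGraph V} {f : ℕ → ℝ}
    (S : Spanner G f) : ℕ :=
  S.H.edgeSet.ncard

/-- The exponent `h = (3·2^(k-1) - (k+2)) / ((γ+1)·2^k - 1)` (used for `k ≥ 2`, `γ ≥ 1`). -/
noncomputable def hExp (γ k : ℕ) : ℝ :=
  (3 * (2 : ℝ) ^ (k - 1) - ((k : ℝ) + 2)) / (((γ : ℝ) + 1) * (2 : ℝ) ^ k - 1)

end GirthCompression

/-! The construction is a hierarchy of sampled vertex sets `A 0`, `A 1`, ..., `A k = ∅` of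
Thorup–Zwick type, whose lowest level is made sparser by the girth.

Moore bound: when the girth exceeds `2γ`, all but `r n` edges have both ends in balls of radius `γ`
with at least `r ^ γ` vertices (`ncard_edges_touching_le`). Hence about `n / ρ ^ γ` sampled vertices
come within `γ` of both ends of all but `O(ρ n)` edges, and these exceptional edges are kept. At
each later level, the pairs of `A i` that are not separated by a closer vertex of `A (i + 1)` form
the bunch, of size `O(s i ^ 2 / s (i + 1))` if the levels have sizes `s i`. Balancing these
quantities produces the exponent `1 / ((γ + 1) 2 ^ k - 1)`.

Stretch is an induction on levels (`Dichotomy.step`). A pair at distance at most `l` is either well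
approximated or near the current level at both ends. On a longer path, only the stretch between its
first and last bad piece is bypassed, through two pivots; if these pivots are not joined directly,
the next level is near both of them. At the top the next level is empty, so the path must succeed.

In an emulator a bunch pair costs one weighted edge, and the graph does not depend on the lengths
used in the induction. These can therefore be optimised for each distance `d` separately, which
gives sublinear error. In a spanner a bunch pair costs a path, so the lengths are fixed powers of
some `q` of order `γ k / ε` and the level sizes absorb the cost. On the lowest level, path buying
(`exists_path_buying`) costs only `O(γ ^ 2)` edges per pair, whatever the distance. -/

namespace GirthCompression

/-! ### Walks of bounded length -/

section Within

variable {V : Type u} {G H : SimpleGraph V} {x y z : V} {m n : ℕ}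

/-- There is a walk of length at most `n` from `x` to `y`. -/
def Within (G : SimpleGraph V) (n : ℕ) (x y : V) : Prop := ∃ p : G.Walk x y, p.length ≤ n

lemma Within.refl (G : SimpleGraph V) (n : ℕ) (x : V) : Within G n x x := ⟨.nil, by simp⟩

lemma Within.symm (h : Within G n x y) : Within G n y x := by
  obtain ⟨p, hp⟩ := h
  exact ⟨p.reverse, by simpa using hp⟩

lemma Within.trans (h : Within G m x y) (h' : Within G n y z) : Within G (m + n) x z := by
  obtain ⟨p, hp⟩ := h
  obtain ⟨q, hq⟩ := h'
  exact ⟨p.append q, by rw [SimpleGraph.Walk.length_append]; omega⟩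

lemma Within.mono (h : Within G m x y) (hmn : m ≤ n) : Within G n x y := by
  obtain ⟨p, hp⟩ := h
  exact ⟨p, hp.trans hmn⟩

lemma Within.of_le (h : Within G n x y) (hGH : G ≤ H) : Within H n x y := by
  obtain ⟨p, hp⟩ := h
  exact ⟨p.mapLe hGH, by simpa using hp⟩

lemma Within.of_adj (h : G.Adj x y) : Within G 1 x y := ⟨h.toWalk, by simp⟩

lemma Within.reachable (h : Within G n x y) : G.Reachable x y := h.choose.reachable

lemma Within.dist_le (h : Within G n x y) : G.dist x y ≤ n := by
  obtain ⟨p, hp⟩ := h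
  exact (SimpleGraph.dist_le p).trans hp

lemma within_dist (h : G.Reachable x y) : Within G (G.dist x y) x y := by
  obtain ⟨p, hp⟩ := h.exists_walk_length_eq_dist
  exact ⟨p, hp.le⟩

lemma within_zero_iff : Within G 0 x y ↔ x = y := by
  constructor
  · rintro ⟨p, hp⟩
    exact SimpleGraph.Walk.eq_of_length_eq_zero (Nat.le_zero.1 hp)
  · rintro rfl
    exact .refl _ _ _

lemma within_getVert (p : G.Walk x y) {i j : ℕ} (hij : i ≤ j) :
    Within G (j - i) (p.getVert i) (p.getVert j) := by
  refine Nat.le_induction (Within.refl _ _ _) (fun j hj ih ↦ ?_) j hij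
  by_cases h : j < p.length
  · exact (ih.trans (.of_adj (p.adj_getVert_succ h))).mono (by omega)
  · have : p.getVert (j + 1) = p.getVert j := by
      rw [p.getVert_of_length_le (i := j + 1) (by omega), p.getVert_of_length_le (by omega)]
    rw [this]
    exact ih.mono (by omega)

end Within

/-! ### The inductive step for the stretch -/

section Step

variable {V : Type u}

/-- The laws of the relation `T n x y`, that `x` and `y` are at distance at most `n`. -/
structure DistRel (T : ℕ → V → V → Prop) : Prop where
  refl : ∀ x, T 0 x x
  symm : ∀ {n x y}, T n x y → T n y x
  trans : ∀ {m n x y z}, T m x y → T n y z → T (m + n) x z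
  mono : ∀ {m n x y}, T m x y → m ≤ n → T n x y

lemma distRel_within (G : SimpleGraph V) : DistRel (Within G) where
  refl := Within.refl G 0
  symm := Within.symm
  trans := Within.trans
  mono := Within.mono

/-- Some vertex of `A` is at distance at most `n` from `x`. -/
def Meets (G : SimpleGraph V) (A : Finset V) (n : ℕ) (x : V) : Prop := ∃ a ∈ A, Within G n x a

lemma Meets.mono {G : SimpleGraph V} {A : Finset V} {m n : ℕ} {x : V} (h : Meets G A m x)
    (hmn : m ≤ n) : Meets G A n x := by
  obtain ⟨a, ha, h⟩ := h
  exact ⟨a, ha, h.mono hmn⟩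

lemma Meets.trans {G : SimpleGraph V} {A : Finset V} {m n : ℕ} {x y : V} (h : Meets G A m y)
    (hxy : Within G n x y) : Meets G A (n + m) x := by
  obtain ⟨a, ha, h⟩ := h
  exact ⟨a, ha, hxy.trans h⟩

/-- Pairs at distance at most `l` in `G` either have additive stretch `e` or are both within `R`
of `A`. -/
def Dichotomy (G : SimpleGraph V) (T : ℕ → V → V → Prop) (A : Finset V) (l e R : ℕ) : Prop :=
  ∀ x y d, d ≤ l → Within G d x y → T (d + e) x y ∨ Meets G A R x ∧ Meets G A R y

lemma Dichotomy.mono {G : SimpleGraph V} {T : ℕ → V → V → Prop} (hT : DistRel T) {A : Finset V}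
    {l e R l' e' R' : ℕ} (h : Dichotomy G T A l e R) (hl : l' ≤ l) (he : e ≤ e') (hR : R ≤ R') :
    Dichotomy G T A l' e' R' := by
  intro x y d hd hxy
  rcases h x y d (hd.trans hl) hxy with h | ⟨h, h'⟩
  · exact .inl (hT.mono h (by omega))
  · exact .inr ⟨h.mono hR, h'.mono hR⟩

lemma DistRel.chain {T : ℕ → V → V → Prop} (hT : DistRel T) (z : ℕ → V) (t : ℕ → ℕ)
    (ht : Monotone t) (e : ℕ) {i j : ℕ} (hij : i ≤ j)
    (h : ∀ l, i ≤ l → l < j → T (t (l + 1) - t l + e) (z l) (z (l + 1))) :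
    T (t j - t i + (j - i) * e) (z i) (z j) := by
  induction j, hij using Nat.le_induction with
  | base => exact hT.mono (hT.refl _) (Nat.zero_le _)
  | succ j hj ih =>
    refine hT.mono (hT.trans (ih fun l hl hlj ↦ h l hl (by omega)) (h j hj (by omega))) ?_
    have h1 := ht hj
    have h2 := ht (Nat.le_succ j)
    rw [show j + 1 - i = j - i + 1 by omega, add_mul, one_mul]
    simp only [Nat.succ_eq_add_one] at h2
    omega

/-- Cut the walk into `q` pieces of length at most `l`. If all are good, their errors add up to `q *
e`. Otherwise leave the walk at the start of the first bad piece and return at the end of the last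
one, through pivots `a`, `b` of `A`. The two pivot legs cost `2 R` and the distance between `a` and
`b` exceeds that along the walk by at most `2 R`, whence `4 R`; at least one piece is bypassed,
whence `q - 1`. If `a` and `b` are not joined, they see `A'` within `q * l + 2 * R`, and `x` and `y`
see it within `R` more. -/
theorem Dichotomy.step {G : SimpleGraph V} {T : ℕ → V → V → Prop} (hT : DistRel T)
    {A A' : Finset V} {l e R e' : ℕ} (q : ℕ) (h : Dichotomy G T A l e R)
    (hA : ∀ x n, Meets G A n x → ∃ a ∈ A, Within G n x a ∧ T n x a)
    (hAA' : ∀ a ∈ A, ∀ b ∈ A, ∀ n ≤ q * l + 2 * R, Within G n a b →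
      T n a b ∨ Meets G A' n a ∧ Meets G A' n b)
    (he : q * e ≤ e') (he' : (q - 1) * e + 4 * R ≤ e') :
    Dichotomy G T A' (q * l) e' (q * l + 3 * R) := by
  intro x y d hd ⟨p, hp⟩
  set t : ℕ → ℕ := fun j ↦ min (j * l) d with ht
  -- Truncating the cut points at `d` lets trailing pieces be trivial, so there are always exactly
  -- `q` pieces.
  have htm : Monotone t := fun i j hij ↦ min_le_min_right _ (Nat.mul_le_mul_right _ hij)
  set z : ℕ → V := fun j ↦ p.getVert (t j) with hz
  have hz0 : z 0 = x := by simp [hz, ht]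
  have hzq : z q = y := by
    simp only [hz, ht]
    exact p.getVert_of_length_le (by omega)
  have ht0 : t 0 = 0 := by simp [ht]
  have htq : t q = d := by simp only [ht]; omega
  have hw : ∀ i j, i ≤ j → Within G (t j - t i) (z i) (z j) :=
    fun i j hij ↦ within_getVert p (htm hij)
  have hts : ∀ j, t (j + 1) - t j ≤ l := by
    intro j
    simp only [ht, add_mul, one_mul]
    omega
  have hpc : ∀ j, T (t (j + 1) - t j + e) (z j) (z (j + 1)) ∨
      Meets G A R (z j) ∧ Meets G A R (z (j + 1)) :=
    fun j ↦ h _ _ _ (hts j) (hw _ _ (Nat.le_succ j))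
  classical
  set B := (Finset.range q).filter fun j ↦ ¬ T (t (j + 1) - t j + e) (z j) (z (j + 1)) with hB
  by_cases hBe : B.Nonempty
  · set i := B.min' hBe
    set j := B.max' hBe
    have hi := B.min'_mem hBe
    have hj := B.max'_mem hBe
    have hij : i ≤ j := B.min'_le _ hj
    have hjq : j < q := Finset.mem_range.1 (Finset.mem_filter.1 hj).1
    have hi' := ((hpc i).resolve_left (Finset.mem_filter.1 hi).2).1
    have hj' := ((hpc j).resolve_left (Finset.mem_filter.1 hj).2).2
    have h1 : T (t i - t 0 + (i - 0) * e) (z 0) (z i) := by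
      refine hT.chain z t htm e (Nat.zero_le _) fun m _ hm ↦ ?_
      by_contra hc
      have := B.min'_le m (Finset.mem_filter.2 ⟨by simp; omega, hc⟩)
      omega
    have h2 : T (t q - t (j + 1) + (q - (j + 1)) * e) (z (j + 1)) (z q) := by
      refine hT.chain z t htm e hjq fun m hm hmq ↦ ?_
      by_contra hc
      have := B.le_max' m (Finset.mem_filter.2 ⟨by simp; omega, hc⟩)
      omega
    have m1 : t 0 ≤ t i := htm (Nat.zero_le _)
    have m2 : t i ≤ t (j + 1) := htm (by omega)
    have m3 : t (j + 1) ≤ t q := htm hjq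
    rw [hz0] at h1
    rw [hzq] at h2
    obtain ⟨a, ha, hia, hTa⟩ := hA _ _ hi'
    obtain ⟨b, hb, hjb, hTb⟩ := hA _ _ hj'
    have hab : Within G (t (j + 1) - t i + 2 * R) a b :=
      ((hia.symm.trans (hw i (j + 1) (by omega))).trans hjb).mono (by omega)
    rcases hAA' a ha b hb _ (by omega) hab with hTab | ⟨h3, h4⟩
    · left
      refine hT.mono (hT.trans (hT.trans (hT.trans (hT.trans h1 hTa) hTab) (hT.symm hTb)) h2) ?_
      have : (i - 0) * e + (q - (j + 1)) * e ≤ (q - 1) * e := by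
        rw [← add_mul]
        exact Nat.mul_le_mul_right _ (by omega)
      omega
    · right
      have hxi := hw 0 i (Nat.zero_le _)
      have hyj := (hw (j + 1) q hjq).symm
      rw [hz0] at hxi
      rw [hzq] at hyj
      exact ⟨((h3.trans hia).trans hxi).mono (by omega), ((h4.trans hjb).trans hyj).mono (by omega)⟩
  · left
    have h1 : T (t q - t 0 + (q - 0) * e) (z 0) (z q) := by
      refine hT.chain z t htm e (Nat.zero_le _) fun m _ hm ↦ ?_
      by_contra hc
      exact hBe ⟨m, Finset.mem_filter.2 ⟨by simpa using hm, hc⟩⟩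
    rw [hz0, hzq] at h1
    exact hT.mono h1 (by simp only [Nat.sub_zero]; omega)

end Step

/-! ### Derandomised sampling -/

section Sampling

open Finset

/-- The right-hand side is the expected number of sets missed by `m` independent uniform samples.
The method of conditional expectations replaces probability: some `v` does at least as well as the
average, and the sets avoiding `v` are handled by induction. -/
lemma exists_hitting_le_sum {V ι : Type*} [DecidableEq V] (X : Finset V) (B : ι → Finset V)
    (hB : ∀ i, B i ⊆ X) (m : ℕ) (I : Finset ι) :
    ∃ S ⊆ X, #S ≤ m ∧
      (#{i ∈ I | Disjoint (B i) S} : ℝ) ≤ ∑ i ∈ I, (1 - (#(B i) : ℝ) / #X) ^ m := by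
  rcases X.eq_empty_or_nonempty with rfl | hX
  · refine ⟨∅, by simp, by simp, ?_⟩
    simp
  have hX0 : (0 : ℝ) < #X := by exact_mod_cast hX.card_pos
  induction m generalizing I with
  | zero => exact ⟨∅, by simp, by simp, by simp⟩
  | succ m ih =>
    have key : ∑ v ∈ X, ∑ i ∈ I with v ∉ B i, (1 - (#(B i) : ℝ) / #X) ^ m
        = #X * ∑ i ∈ I, (1 - (#(B i) : ℝ) / #X) ^ (m + 1) := by
      simp_rw [sum_filter]
      rw [sum_comm, mul_sum]
      refine sum_congr rfl fun i _ ↦ ?_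
      rw [← sum_filter, sum_const, nsmul_eq_mul, pow_succ', ← mul_assoc]
      congr 1
      have h1 : ({v ∈ X | v ∉ B i} : Finset V) = X \ B i := by ext; simp
      rw [h1, cast_card_sdiff (hB i)]
      field_simp
    obtain ⟨v, hv, hle⟩ : ∃ v ∈ X, ∑ i ∈ I with v ∉ B i, (1 - (#(B i) : ℝ) / #X) ^ m
        ≤ ∑ i ∈ I, (1 - (#(B i) : ℝ) / #X) ^ (m + 1) := by
      by_contra! hc
      have := sum_lt_sum_of_nonempty hX hc
      rw [key, sum_const, nsmul_eq_mul] at this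
      exact lt_irrefl _ this
    obtain ⟨S, hSX, hSm, hS⟩ := ih ({i ∈ I | v ∉ B i})
    refine ⟨insert v S, insert_subset hv hSX, (card_insert_le _ _).trans (by omega), ?_⟩
    refine le_trans (le_trans ?_ hS) hle
    rw [filter_filter]
    exact_mod_cast card_le_card fun i hi ↦ by
      simpa [disjoint_insert_right] using hi

/-- Summation by layers: linear growth of the counts against geometric decay gives `K` times the
series of `j / 2 ^ j`, whose value is 2. This is what avoids a logarithmic factor in the sampling
bounds. -/
lemma sum_two_pow_neg_le {ι : Type*} (I : Finset ι) (f : ι → ℕ) (K : ℝ) (hK : 0 ≤ K)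
    (h : ∀ j : ℕ, 1 ≤ j → (#{i ∈ I | f i < j} : ℝ) ≤ K * j) :
    ∑ i ∈ I, (1 / 2 : ℝ) ^ f i ≤ 2 * K := by
  obtain ⟨M, hM⟩ : ∃ M, ∀ i ∈ I, f i ≤ M := ⟨I.sup f, fun i hi ↦ le_sup hi⟩
  -- The geometric tail from `a` on, cut at `M`, with its remainder as a separate term.
  have tail : ∀ M a : ℕ, a ≤ M → (1 / 2 : ℝ) ^ a = (1 / 2) ^ (M + 1) +
      ∑ j ∈ range (M + 1), if a < j + 1 then (1 / 2 : ℝ) ^ (j + 1) else 0 := by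
    intro M
    induction M with
    | zero =>
      intro a ha
      obtain rfl : a = 0 := by omega
      norm_num
    | succ M ih =>
      intro a ha
      rw [sum_range_succ]
      rcases Nat.lt_or_ge M a with h | h
      · obtain rfl : a = M + 1 := by omega
        rw [sum_eq_zero, if_pos (by omega)]
        · ring
        · intro j hj
          rw [if_neg]
          simp only [mem_range] at hj
          omega
      · rw [ih a h, if_pos (by omega)]
        ring
  have gsum : ∀ M : ℕ, ∑ j ∈ range M, (1 / 2 : ℝ) ^ (j + 1) * (K * ((j + 1 : ℕ) : ℝ))
      = K * (2 - (M + 2) * (1 / 2) ^ M) := by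
    intro M
    induction M with
    | zero => norm_num
    | succ M ih =>
      rw [sum_range_succ, ih]
      push_cast
      ring
  have hI : (#I : ℝ) ≤ K * (M + 1 : ℕ) := by
    refine le_trans ?_ (h (M + 1) (by omega))
    exact_mod_cast card_le_card fun i hi ↦ mem_filter.2 ⟨hi, Nat.lt_succ_of_le (hM i hi)⟩
  calc ∑ i ∈ I, (1 / 2 : ℝ) ^ f i
      = ∑ i ∈ I, ((1 / 2) ^ (M + 1) +
          ∑ j ∈ range (M + 1), if f i < j + 1 then (1 / 2 : ℝ) ^ (j + 1) else 0) :=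
        sum_congr rfl fun i hi ↦ tail M _ (hM i hi)
    _ = #I * (1 / 2) ^ (M + 1) +
          ∑ j ∈ range (M + 1), (1 / 2 : ℝ) ^ (j + 1) * #{i ∈ I | f i < j + 1} := by
        rw [sum_add_distrib, sum_const, nsmul_eq_mul, sum_comm]
        congr 1
        refine sum_congr rfl fun j _ ↦ ?_
        rw [← sum_filter, sum_const, nsmul_eq_mul, mul_comm]
    _ ≤ K * (M + 1 : ℕ) * (1 / 2) ^ (M + 1) +
          ∑ j ∈ range (M + 1), (1 / 2 : ℝ) ^ (j + 1) * (K * ((j + 1 : ℕ) : ℝ)) := by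
        gcongr with j hj
        exact h (j + 1) (by omega)
    _ ≤ 2 * K := by
        rw [gsum]
        push_cast
        have : 0 ≤ K * (1 / 2 : ℝ) ^ (M + 1) := by positivity
        nlinarith

/-- Sampling: `m` elements of `X` can be chosen so that few members of a family are missed. -/
theorem exists_hitting {V ι : Type*} [DecidableEq V] (X : Finset V) (B : ι → Finset V)
    (hB : ∀ i, B i ⊆ X) (m : ℕ) (I : Finset ι) (K : ℝ) (hK : 0 ≤ K)
    (h : ∀ j : ℕ, 1 ≤ j → (#{i ∈ I | m * #(B i) / #X < j} : ℝ) ≤ K * j) :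
    ∃ S ⊆ X, #S ≤ m ∧ (#{i ∈ I | Disjoint (B i) S} : ℝ) ≤ 2 * K := by
  obtain ⟨S, hSX, hSm, hS⟩ := exists_hitting_le_sum X B hB m I
  refine ⟨S, hSX, hSm, hS.trans ?_⟩
  refine le_trans (sum_le_sum fun i _ ↦ ?_)
    (sum_two_pow_neg_le I (fun i ↦ m * #(B i) / #X) K hK h)
  have hb : (#(B i) : ℝ) / #X ≤ 1 :=
    div_le_one_of_le₀ (by exact_mod_cast card_le_card (hB i)) (by positivity)
  calc (1 - (#(B i) : ℝ) / #X) ^ m ≤ (Real.exp (-((#(B i) : ℝ) / #X))) ^ m := by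
        refine pow_le_pow_left₀ (by linarith) ?_ m
        have := Real.add_one_le_exp (-((#(B i) : ℝ) / #X))
        linarith
    _ = Real.exp (-(((m * #(B i) : ℕ) : ℝ) / (#X : ℕ))) := by
        rw [← Real.exp_nat_mul]
        congr 1
        push_cast
        ring
    _ ≤ Real.exp (-((m * #(B i) / #X : ℕ) : ℝ)) := by
        refine Real.exp_le_exp.2 (neg_le_neg Nat.cast_div_le)
    _ = (Real.exp (-1)) ^ (m * #(B i) / #X) := by
        rw [← Real.exp_nat_mul]
        congr 1
        ring
    _ ≤ (1 / 2 : ℝ) ^ (m * #(B i) / #X) := by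
        refine pow_le_pow_left₀ (Real.exp_nonneg _) ?_ _
        rw [Real.exp_neg, one_div]
        refine inv_anti₀ (by norm_num) ?_
        have := Real.add_one_le_exp (1 : ℝ)
        linarith

end Sampling

/-! ### Large balls from large girth -/

section Moore

open Finset

variable {V : Type u}

/-- The edges of both paths form a graph with at most `l` edges, too few for a cycle of `G`; in an
acyclic graph paths are unique. -/
lemma path_unique_of_le_egirth {G : SimpleGraph V} {l : ℕ} (hG : ((l + 1 : ℕ) : ℕ∞) ≤ G.egirth)
    {u v : V} {p q : G.Walk u v} (hp : p.IsPath) (hq : q.IsPath) (hpq : p.length + q.length ≤ l) :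
    p = q := by
  classical
  set K := SimpleGraph.fromEdgeSet {e | e ∈ p.edges ∨ e ∈ q.edges} with hK
  have hpK : ∀ e ∈ p.edges, e ∈ K.edgeSet := fun e he ↦ by
    rw [hK, SimpleGraph.edgeSet_fromEdgeSet]
    exact ⟨.inl he, G.not_isDiag_of_mem_edgeSet (p.edges_subset_edgeSet he)⟩
  have hqK : ∀ e ∈ q.edges, e ∈ K.edgeSet := fun e he ↦ by
    rw [hK, SimpleGraph.edgeSet_fromEdgeSet]
    exact ⟨.inr he, G.not_isDiag_of_mem_edgeSet (q.edges_subset_edgeSet he)⟩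
  have hKe : ∀ e ∈ K.edgeSet, e ∈ p.edges ∨ e ∈ q.edges := fun e he ↦ by
    rw [hK, SimpleGraph.edgeSet_fromEdgeSet] at he
    exact he.1
  have hKG : K ≤ G := by
    rw [← SimpleGraph.edgeSet_subset_edgeSet]
    rintro e he
    rcases hKe e he with h | h
    · exact p.edges_subset_edgeSet h
    · exact q.edges_subset_edgeSet h
  have hac : K.IsAcyclic := by
    intro a c hc
    have h1 : (c.edges.toFinset) ⊆ p.edges.toFinset ∪ q.edges.toFinset := by
      intro e he
      simpa using hKe e (c.edges_subset_edgeSet (List.mem_toFinset.1 he))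
    have h2 : c.length ≤ l := by
      rw [← c.length_edges, ← List.toFinset_card_of_nodup hc.edges_nodup]
      refine (card_le_card h1).trans ((card_union_le _ _).trans (le_trans ?_ hpq))
      refine add_le_add ?_ ?_
      · exact (List.toFinset_card_le _).trans p.length_edges.le
      · exact (List.toFinset_card_le _).trans q.length_edges.le
    have h3 := (hG.trans (SimpleGraph.egirth_anti hKG)).trans (SimpleGraph.egirth_le_length hc)
    have h4 : l + 1 ≤ c.length := by exact_mod_cast h3
    omega
  have := (hac.subsingleton_path u v).elim ⟨p.transfer K hpK, hp.transfer hpK⟩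
    ⟨q.transfer K hqK, hq.transfer hqK⟩
  have h5 : p.transfer K hpK = q.transfer K hqK := congrArg Subtype.val this
  apply SimpleGraph.Walk.ext_support
  rw [← p.support_transfer hpK, ← q.support_transfer hqK, h5]

/-- Shortest paths from `u` to `z` and `z'` avoid `w`, so appending `w` yields two paths from `u` to
`w` of total length at most `2 γ`, which coincide. Within radius `γ` the graph thus looks like a
tree seen from `u`. -/
lemma eq_of_adj_of_dist_le {G : SimpleGraph V} {γ : ℕ} (hG : ((2 * γ + 1 : ℕ) : ℕ∞) ≤ G.egirth)
    {u w z z' : V} (hz : G.Adj w z) (hz' : G.Adj w z') (hu : G.Reachable u w)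
    (h1 : G.dist u z ≤ G.dist u w) (h1' : G.dist u z' ≤ G.dist u w)
    (h2 : G.dist u z + 1 ≤ γ) (h2' : G.dist u z' + 1 ≤ γ) : z = z' := by
  have key : ∀ y, G.Adj w y → G.dist u y ≤ G.dist u w →
      ∃ p : G.Walk u y, p.length = G.dist u y ∧ p.IsPath ∧ w ∉ p.support := by
    intro y hy hyd
    obtain ⟨p, hp, hpl⟩ := (hu.trans hy.reachable).exists_path_of_dist
    refine ⟨p, hpl, hp, fun hw ↦ ?_⟩
    classical
    have h3 := SimpleGraph.dist_le (p.takeUntil w hw)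
    have h4 := congrArg SimpleGraph.Walk.length (p.take_spec hw)
    rw [SimpleGraph.Walk.length_append] at h4
    have h5 : (p.dropUntil w hw).length = 0 := by omega
    exact hy.ne (SimpleGraph.Walk.eq_of_length_eq_zero h5)
  obtain ⟨p, hpl, hp, hpw⟩ := key z hz h1
  obtain ⟨p', hpl', hp', hpw'⟩ := key z' hz' h1'
  have := path_unique_of_le_egirth hG (hp.concat hpw hz.symm) (hp'.concat hpw' hz'.symm)
    (by simp only [SimpleGraph.Walk.length_concat]; omega)
  exact (SimpleGraph.Walk.concat_inj this).1

/-- In a graph of large girth whose non-isolated vertices have degree larger than `r`, the balls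
are large. -/
lemma pow_le_card_sphere [Fintype V] {G : SimpleGraph V} {γ r : ℕ} [DecidableRel G.Adj]
    [∀ n x, DecidablePred (fun v ↦ G.Reachable x v ∧ G.dist x v = n)]
    (hG : ((2 * γ + 1 : ℕ) : ℕ∞) ≤ G.egirth)
    (hr : ∀ v, G.degree v ≠ 0 → r + 1 ≤ G.degree v) {u : V} (hu : G.degree u ≠ 0) :
    ∀ j ≤ γ, r ^ j ≤ #{v | G.Reachable u v ∧ G.dist u v = j} := by
  classical
  intro j
  induction j with
  | zero =>
    intro _
    rw [pow_zero, Nat.one_le_iff_ne_zero, card_ne_zero]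
    exact ⟨u, by simp⟩
  | succ j ih =>
    intro hj
    refine le_trans ?_ (?_ : #{v | G.Reachable u v ∧ G.dist u v = j} * r ≤ _)
    · rw [pow_succ]
      exact Nat.mul_le_mul_right _ (ih (by omega))
    -- Double counting of the edges between consecutive spheres: at least `r` leave each `w`
    -- outwards, since at most one neighbour is not farther from `u`, and at most one reaches each
    -- `z` from inside.
    · rw [← mul_one (#{v | G.Reachable u v ∧ G.dist u v = j + 1})]
      refine card_mul_le_card_mul G.Adj (fun w hw ↦ ?_) (fun z hz ↦ ?_)
      · simp only [mem_filter, mem_univ, true_and] at hw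
        have hw0 : G.degree w ≠ 0 := by
          rcases eq_or_ne u w with rfl | hne
          · exact hu
          · obtain ⟨p⟩ := hw.1.symm
            cases p with
            | nil => exact absurd rfl hne
            | cons h _ => exact (SimpleGraph.degree_pos_iff_exists_adj _ _).2 ⟨_, h⟩ |>.ne'
        have h1 := hr w hw0
        rw [← SimpleGraph.card_neighborFinset_eq_degree] at h1
        have h2 : #{z ∈ G.neighborFinset w | G.dist u z ≤ j} ≤ 1 := by
          refine card_le_one.2 fun z hz z' hz' ↦ ?_
          simp only [mem_filter, SimpleGraph.mem_neighborFinset] at hz hz'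
          exact eq_of_adj_of_dist_le hG hz.1 hz'.1 hw.1 (by omega) (by omega) (by omega) (by omega)
        have h3 := card_filter_add_card_filter_not (s := G.neighborFinset w)
          (fun z ↦ G.dist u z ≤ j)
        have h4 : {z ∈ G.neighborFinset w | ¬ G.dist u z ≤ j} ⊆
            bipartiteAbove G.Adj {v | G.Reachable u v ∧ G.dist u v = j + 1} w := by
          intro z hz
          simp only [mem_filter, SimpleGraph.mem_neighborFinset] at hz
          simp only [mem_bipartiteAbove, mem_filter, mem_univ, true_and]
          have hrz := hw.1.trans hz.1.reachable
          refine ⟨⟨hrz, ?_⟩, hz.1⟩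
          have := ((within_dist hw.1).trans (.of_adj hz.1)).dist_le
          omega
        have := card_le_card h4
        omega
      · simp only [mem_filter, mem_univ, true_and] at hz
        refine card_le_one.2 fun w hw w' hw' ↦ ?_
        simp only [mem_bipartiteBelow, mem_filter, mem_univ, true_and] at hw hw'
        exact eq_of_adj_of_dist_le hG hw.2.symm hw'.2.symm hz.1 (by omega) (by omega) (by omega)
          (by omega)

/-- A graph with more than `r * n` edges has a nonempty subgraph whose non-isolated vertices have
degree larger than `r`. -/
lemma exists_large_degree_subgraph [Fintype V] (r : ℕ) (F : SimpleGraph V) [DecidableRel F.Adj]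
    (hF : r * #{v | F.degree v ≠ 0} < #F.edgeFinset) :
    ∃ K ≤ F, K ≠ ⊥ ∧ ∀ [DecidableRel K.Adj], ∀ v, K.degree v ≠ 0 → r + 1 ≤ K.degree v := by
  classical
  induction hn : #F.edgeFinset using Nat.strong_induction_on generalizing F with
  | _ n ih =>
  by_cases h : ∀ v, F.degree v ≠ 0 → r + 1 ≤ F.degree v
  · refine ⟨F, le_rfl, ?_, ?_⟩
    · rintro rfl
      simp at hF
    · intro _ v hv
      convert h v (by convert hv)
  · push Not at h
    obtain ⟨v, hv0, hv⟩ := h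
    have hcard := SimpleGraph.card_edgeFinset_deleteIncidenceSet F v
    have hle : F.degree v ≤ #F.edgeFinset := by
      rw [← SimpleGraph.card_incidenceFinset_eq_degree]
      exact card_le_card (SimpleGraph.incidenceFinset_subset F v)
    have hlt : r * #{w | (F.deleteIncidenceSet v).degree w ≠ 0} <
        #(F.deleteIncidenceSet v).edgeFinset := by
      have h1 : ({w | (F.deleteIncidenceSet v).degree w ≠ 0} : Finset V) ⊆
          ({w | F.degree w ≠ 0} : Finset V).erase v := by
        intro w hw
        simp only [mem_filter, mem_univ, true_and, mem_erase, ← Nat.pos_iff_ne_zero,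
          SimpleGraph.degree_pos_iff_exists_adj, SimpleGraph.deleteIncidenceSet_adj] at hw ⊢
        obtain ⟨z, h1, h2, h3⟩ := hw
        exact ⟨h2, z, h1⟩
      have h2 := card_le_card h1
      rw [card_erase_of_mem (by simpa using hv0)] at h2
      have h3 : 0 < #{w | F.degree w ≠ 0} := card_pos.2 ⟨v, by simpa using hv0⟩
      have h4 := Nat.mul_le_mul_left r h2
      rw [Nat.mul_sub, mul_one] at h4
      have h5 := Nat.mul_le_mul_left r h3
      rw [hcard]
      omega
    obtain ⟨K, hK, hK'⟩ := ih _ (by omega) (F.deleteIncidenceSet v) hlt rfl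
    exact ⟨K, hK.trans (F.deleteIncidenceSet_le v), hK'⟩

/-- Few edges of a graph of large girth touch a vertex with a small ball. -/
theorem ncard_edges_touching_le [Fintype V] {G : SimpleGraph V} {γ r : ℕ}
    (hG : ((2 * γ + 1 : ℕ) : ℕ∞) ≤ G.egirth) :
    {e ∈ G.edgeSet | ∃ u ∈ e, {v | Within G γ u v}.ncard < r ^ γ}.ncard ≤
      r * Fintype.card V := by
  classical
  by_contra! hc
  set E := {e ∈ G.edgeSet | ∃ u ∈ e, {v | Within G γ u v}.ncard < r ^ γ} with hE
  set F := SimpleGraph.fromEdgeSet E with hF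
  have hFE : F.edgeSet = E := by
    rw [hF, SimpleGraph.edgeSet_fromEdgeSet, sdiff_eq_left, Set.disjoint_left]
    intro e he
    exact G.not_isDiag_of_mem_edgeSet he.1
  have hFG : F ≤ G := by
    rw [← SimpleGraph.edgeSet_subset_edgeSet, hFE]
    exact fun e he ↦ he.1
  -- Every edge of `K` has an end whose `γ`-ball in `G` is small, whereas the degrees in `K` already
  -- force `r ^ γ` vertices into that ball.
  obtain ⟨K, hKF, hK0, hK⟩ := exists_large_degree_subgraph r F (by
    refine lt_of_le_of_lt (Nat.mul_le_mul_left r (card_le_univ _)) ?_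
    rw [← Set.ncard_coe_finset, SimpleGraph.coe_edgeFinset, hFE]
    exact hc)
  obtain ⟨e, he⟩ := SimpleGraph.edgeSet_nonempty.2 hK0
  have heE : e ∈ E := hFE ▸ SimpleGraph.edgeSet_subset_edgeSet.2 hKF he
  obtain ⟨u, hue, hu⟩ := heE.2
  obtain ⟨w, rfl⟩ := Sym2.mem_iff_exists.1 hue
  have hKG := hKF.trans hFG
  have h1 := pow_le_card_sphere (hG.trans (SimpleGraph.egirth_anti hKG)) hK (u := u)
    ((SimpleGraph.degree_pos_iff_exists_adj _ _).2 ⟨w, he⟩).ne' γ le_rfl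
  have h2 : #{v | K.Reachable u v ∧ K.dist u v = γ} ≤ {v | Within G γ u v}.ncard := by
    rw [← Set.ncard_coe_finset]
    refine Set.ncard_le_ncard (fun v hv ↦ ?_) (Set.toFinite _)
    simp only [coe_filter, mem_univ, true_and, Set.mem_ofPred_eq] at hv
    exact ((within_dist hv.1).mono hv.2.le).of_le hKG
  omega

end Moore

/-! ### The sampled levels and their sizes -/

section Levels

open Finset

variable {V : Type u}

/-- The edges of `G` with an endpoint that is at distance larger than `γ` from `A`. -/
def sparseEdges (G : SimpleGraph V) (A : Finset V) (γ : ℕ) : Set (Sym2 V) :=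
  {e ∈ G.edgeSet | ∃ u ∈ e, ¬ Meets G A γ u}

/-- The pairs of distinct vertices `a, b` of `A` such that `b` is closer to `a` than `A'` is. -/
def bunch (G : SimpleGraph V) (A A' : Finset V) : Set (V × V) :=
  {p | p.1 ∈ A ∧ p.2 ∈ A ∧ p.1 ≠ p.2 ∧ G.Reachable p.1 p.2 ∧ ¬ Meets G A' (G.dist p.1 p.2) p.1}

/-- The balls are indexed by darts, so that missed balls count edges: a sparse edge is a dart whose
starting ball is missed. Balls with fewer than `j n / m ≤ j ρ ^ γ` vertices belong to at most `4 j ρ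
n` darts by the Moore bound, which is the linear growth that `exists_hitting` asks for. -/
theorem exists_sample_sparseEdges [Fintype V] {G : SimpleGraph V} {γ : ℕ} (hγ : 1 ≤ γ)
    (hG : ((2 * γ + 1 : ℕ) : ℕ∞) ≤ G.egirth) (m : ℕ) (ρ : ℝ) (hρ : 1 ≤ ρ)
    (hm : (Fintype.card V : ℝ) ≤ m * ρ ^ γ) :
    ∃ A : Finset V, #A ≤ m ∧ ((sparseEdges G A γ).ncard : ℝ) ≤ 8 * ρ * Fintype.card V := by
  classical
  set B : G.Dart → Finset V := fun d ↦ {v | Within G γ d.fst v} with hB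
  have hcount : ∀ j : ℕ, 1 ≤ j → (#{d : G.Dart | m * #(B d) / #(univ : Finset V) < j} : ℝ)
      ≤ 4 * ρ * Fintype.card V * j := by
    intro j hj
    set r := ⌈(j : ℝ) * ρ⌉₊
    have hj1 : (1 : ℝ) ≤ j := by exact_mod_cast hj
    have h1 : #{d : G.Dart | m * #(B d) / #(univ : Finset V) < j} ≤ 2 * (r * Fintype.card V) := by
      refine le_trans ?_ (Nat.mul_le_mul_left 2 (ncard_edges_touching_le (r := r) hG))
      rw [← Set.ncard_coe_finset]
      set E := {e ∈ G.edgeSet | ∃ u ∈ e, {v | Within G γ u v}.ncard < r ^ γ} with hE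
      rw [Set.ncard_coe_finset, Set.ncard_eq_toFinset_card' E]
      refine card_le_mul_card_image_of_maps_to (f := SimpleGraph.Dart.edge) ?_ 2 ?_
      · intro d hd
        have hn : 0 < #(univ : Finset V) := card_pos.2 ⟨d.fst, mem_univ _⟩
        simp only [mem_filter, mem_univ, true_and, Nat.div_lt_iff_lt_mul hn] at hd
        rw [Set.mem_toFinset]
        refine ⟨d.edge_mem, d.fst, Sym2.mem_mk_left _ _, ?_⟩
        have h2 : {v | Within G γ d.fst v} = (B d : Set V) := by ext; simp [hB]
        rw [h2, Set.ncard_coe_finset]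
        have h3 : (m : ℝ) * #(B d) < j * Fintype.card V := by exact_mod_cast hd
        have hm0 : (0 : ℝ) < m := by
          rcases Nat.eq_zero_or_pos m with rfl | h
          · have : (0 : ℝ) < Fintype.card V := by exact_mod_cast hn
            rw [Nat.cast_zero, zero_mul] at hm
            linarith
          · exact_mod_cast h
        have h4 : (m : ℝ) * #(B d) < m * (j * ρ ^ γ) := by
          refine h3.trans_le ?_
          calc (j : ℝ) * Fintype.card V ≤ j * (m * ρ ^ γ) := by gcongr
            _ = m * (j * ρ ^ γ) := by ring
        have h5 : (#(B d) : ℝ) < r ^ γ := by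
          refine (lt_of_mul_lt_mul_left h4 hm0.le).trans_le ?_
          -- Here `γ ≥ 1` matters: a factor `j` in the ball size costs at most a factor `j` in `ρ`.
          calc (j : ℝ) * ρ ^ γ ≤ j ^ γ * ρ ^ γ := by
                gcongr
                exact le_self_pow₀ hj1 (by omega)
            _ = (j * ρ) ^ γ := (mul_pow _ _ _).symm
            _ ≤ (r : ℝ) ^ γ := by
                gcongr
                exact Nat.le_ceil _
        exact_mod_cast h5
      · intro e he
        rw [Set.mem_toFinset] at he
        rw [← G.dart_edge_fiber_card e he.1]
        exact card_le_card (filter_subset_filter _ (filter_subset _ _))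
    have h2 : (r : ℝ) ≤ 2 * (j * ρ) := by
      have := (Nat.ceil_lt_add_one (by positivity : (0 : ℝ) ≤ j * ρ)).le
      nlinarith
    calc (#{d : G.Dart | m * #(B d) / #(univ : Finset V) < j} : ℝ)
        ≤ 2 * (r * Fintype.card V) := by exact_mod_cast h1
      _ ≤ 2 * (2 * (j * ρ) * Fintype.card V) := by gcongr
      _ = _ := by ring
  obtain ⟨A, -, hAm, hA⟩ := exists_hitting univ B (fun _ ↦ subset_univ _) m univ
    (4 * ρ * Fintype.card V) (by positivity) hcount
  refine ⟨A, hAm, ?_⟩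
  have h1 : sparseEdges G A γ ⊆
      ((({d | Disjoint (B d) A} : Finset G.Dart).image SimpleGraph.Dart.edge : Finset _) :
        Set (Sym2 V)) := by
    rintro e ⟨he, u, hu, hue⟩
    obtain ⟨w, rfl⟩ := Sym2.mem_iff_exists.1 hu
    simp only [coe_image, Set.mem_image, mem_coe, mem_filter, mem_univ, true_and]
    refine ⟨⟨(u, w), he⟩, ?_, rfl⟩
    rw [disjoint_left]
    intro a ha haA
    exact hue ⟨a, haA, by simpa [hB] using ha⟩
  have h2 := Set.ncard_le_ncard h1 (Finset.finite_toSet _)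
  rw [Set.ncard_coe_finset] at h2
  have h3 : ((sparseEdges G A γ).ncard : ℝ) ≤ #{d | Disjoint (B d) A} := by
    exact_mod_cast h2.trans card_image_le
  linarith

/-- A pair `(u, w)` is in the bunch only if the sample misses the part of `A` that is at least as
close to `u` as `w` is. For fixed `u` these sets are nested by distance, so few of them are small.
-/
theorem exists_sample_bunch [Finite V] (G : SimpleGraph V) (A : Finset V) (m : ℕ) (hm : 1 ≤ m) :
    ∃ A' : Finset V, #A' ≤ m ∧ ((bunch G A A').ncard : ℝ) * m ≤ 2 * (#A : ℝ) ^ 2 := by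
  classical
  have hm0 : (0 : ℝ) < m := by exact_mod_cast hm
  set I : Finset (V × V) := {p ∈ A ×ˢ A | G.Reachable p.1 p.2} with hI
  set B : V × V → Finset V := fun p ↦ {w ∈ A | Within G (G.dist p.1 p.2) p.1 w} with hB
  have hcount : ∀ j : ℕ, 1 ≤ j →
      (#{p ∈ I | m * #(B p) / #A < j} : ℝ) ≤ (#A : ℝ) ^ 2 / m * j := by
    intro j hj
    have h1 : m * #{p ∈ I | m * #(B p) / #A < j} ≤ j * #A * #A := by
      have hsub : {p ∈ I | m * #(B p) / #A < j} ⊆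
          A.biUnion fun u ↦ ({w ∈ A | G.Reachable u w ∧ m * #(B (u, w)) / #A < j}).image
            (Prod.mk u) := by
        rintro ⟨u, w⟩ hp
        simp only [hI, mem_filter, mem_product] at hp
        simp only [mem_biUnion, mem_image, mem_filter]
        exact ⟨u, hp.1.1.1, w, ⟨hp.1.1.2, hp.1.2, hp.2⟩, rfl⟩
      have hu : ∀ u ∈ A, m * #{w ∈ A | G.Reachable u w ∧ m * #(B (u, w)) / #A < j} ≤ j * #A := by
        intro u hu
        set W : Finset V := {w ∈ A | G.Reachable u w ∧ m * #(B (u, w)) / #A < j} with hW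
        rcases W.eq_empty_or_nonempty with h | h
        · simp [h]
        -- The ball reaching the farthest such `w` contains all the others, and it is itself small.
        · obtain ⟨w, hw, hmax⟩ := exists_max_image W (G.dist u) h
          have hWB : W ⊆ B (u, w) := by
            intro w' hw'
            have h1 := (mem_filter.1 hw').2.1
            exact mem_filter.2 ⟨(mem_filter.1 hw').1, (within_dist h1).mono (hmax w' hw')⟩
          have h2 := (mem_filter.1 hw).2.2
          rw [Nat.div_lt_iff_lt_mul (card_pos.2 ⟨u, hu⟩)] at h2
          exact (Nat.mul_le_mul_left m (card_le_card hWB)).trans h2.le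
      calc m * #{p ∈ I | m * #(B p) / #A < j}
          ≤ m * ∑ u ∈ A, #{w ∈ A | G.Reachable u w ∧ m * #(B (u, w)) / #A < j} := by
            refine Nat.mul_le_mul_left m ((card_le_card hsub).trans (card_biUnion_le.trans ?_))
            exact sum_le_sum fun u _ ↦ card_image_le
        _ = ∑ u ∈ A, m * #{w ∈ A | G.Reachable u w ∧ m * #(B (u, w)) / #A < j} := mul_sum _ _ _
        _ ≤ ∑ u ∈ A, j * #A := sum_le_sum hu
        _ = j * #A * #A := by rw [sum_const, smul_eq_mul]; ring
    have h2 : (m : ℝ) * #{p ∈ I | m * #(B p) / #A < j} ≤ j * #A * #A := by exact_mod_cast h1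
    rw [div_mul_eq_mul_div, le_div_iff₀ hm0]
    linarith
  obtain ⟨A', -, hAm, hA'⟩ := exists_hitting A B (fun _ ↦ filter_subset _ _) m I
    ((#A : ℝ) ^ 2 / m) (by positivity) hcount
  refine ⟨A', hAm, ?_⟩
  have h1 : bunch G A A' ⊆ (({p ∈ I | Disjoint (B p) A'} : Finset _) : Set (V × V)) := by
    rintro ⟨u, w⟩ ⟨hu, hw, -, hr, hM⟩
    simp only [coe_filter, hI, mem_filter, mem_product, Set.mem_ofPred_eq]
    refine ⟨⟨⟨hu, hw⟩, hr⟩, disjoint_left.2 fun a ha haA ↦ hM ⟨a, haA, ?_⟩⟩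
    exact (mem_filter.1 ha).2
  have h2 := Set.ncard_le_ncard h1 (Finset.finite_toSet _)
  rw [Set.ncard_coe_finset] at h2
  have h3 : ((bunch G A A').ncard : ℝ) ≤ 2 * ((#A : ℝ) ^ 2 / m) :=
    le_trans (by exact_mod_cast h2) hA'
  calc ((bunch G A A').ncard : ℝ) * m ≤ 2 * ((#A : ℝ) ^ 2 / m) * m := by gcongr
    _ = _ := by field_simp

lemma ncard_bunch_le_sq [Finite V] (G : SimpleGraph V) (A A' : Finset V) :
    (bunch G A A').ncard ≤ #A ^ 2 := by
  classical
  rw [sq, ← card_product, ← Set.ncard_coe_finset]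
  exact Set.ncard_le_ncard (fun p hp ↦ mem_product.2 ⟨hp.1, hp.2.1⟩) (Finset.finite_toSet _)

lemma bunch_eq_empty (G : SimpleGraph V) {A : Finset V} (A' : Finset V) (h : #A ≤ 1) :
    bunch G A A' = ∅ :=
  Set.eq_empty_of_forall_notMem fun _ hp ↦ hp.2.2.1 (card_le_one.1 h _ hp.1 _ hp.2.1)

/-- The levels have `⌈σ i⌉₊` elements at most. Rounding is harmless: if `σ i ≤ 1`, a level has at
most one vertex and no bunch pair; otherwise the ceiling is at most `2 σ i`. The last level is
replaced by `∅`, which `σ k ≤ 1` pays for. -/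
theorem exists_levels [Fintype V] {G : SimpleGraph V} {γ : ℕ} (hγ : 1 ≤ γ)
    (hG : ((2 * γ + 1 : ℕ) : ℕ∞) ≤ G.egirth) (k : ℕ) (hk : 1 ≤ k) (ρ : ℝ) (hρ : 1 ≤ ρ)
    (σ : ℕ → ℝ) (hσ : ∀ i, 0 < σ i) (hσk : σ k ≤ 1)
    (h0 : (Fintype.card V : ℝ) ≤ σ 0 * ρ ^ γ) :
    ∃ A : ℕ → Finset V, A k = ∅ ∧
      ((sparseEdges G (A 0) γ).ncard : ℝ) ≤ 8 * ρ * Fintype.card V ∧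
      ∀ i < k, ((bunch G (A i) (A (i + 1))).ncard : ℝ) ≤ 8 * (σ i ^ 2 / σ (i + 1)) := by
  classical
  have hs : ∀ i, 1 ≤ ⌈σ i⌉₊ := fun i ↦ Nat.one_le_iff_ne_zero.2 (Nat.ceil_pos.2 (hσ i)).ne'
  obtain ⟨A₀, hA₀, hA₀'⟩ := exists_sample_sparseEdges hγ hG ⌈σ 0⌉₊ ρ hρ
    (h0.trans (by gcongr; exact Nat.le_ceil _))
  choose next hnext hnext' using fun (i : ℕ) (A : Finset V) ↦
    exists_sample_bunch G A ⌈σ (i + 1)⌉₊ (hs _)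
  let A' : ℕ → Finset V := fun i ↦ Nat.rec A₀ (fun i A ↦ next i A) i
  have hA'c : ∀ i, #(A' i) ≤ ⌈σ i⌉₊ := by
    intro i
    cases i with
    | zero => exact hA₀
    | succ i => exact hnext i _
  let A : ℕ → Finset V := fun i ↦ if i < k then A' i else ∅
  have hAA' : ∀ i < k, A i = A' i := fun i hi ↦ if_pos hi
  refine ⟨A, if_neg (lt_irrefl _), ?_, ?_⟩
  · rw [hAA' 0 (by omega)]
    exact hA₀'
  · intro i hi
    have hpos : 0 ≤ 8 * (σ i ^ 2 / σ (i + 1)) :=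
      mul_nonneg (by norm_num) (div_nonneg (sq_nonneg _) (hσ _).le)
    rw [hAA' i hi]
    rcases le_or_gt (σ i) 1 with h1 | h1
    · rw [bunch_eq_empty]
      · simpa using hpos
      · exact (hA'c i).trans (Nat.ceil_le.2 (by simpa using h1))
    · have hc : (#(A' i) : ℝ) ≤ 2 * σ i := by
        have h2 : (#(A' i) : ℝ) ≤ ⌈σ i⌉₊ := by exact_mod_cast hA'c i
        have h3 := (Nat.ceil_lt_add_one (hσ i).le).le
        linarith
      rcases Nat.lt_or_ge (i + 1) k with hk' | hk'
      · rw [hAA' _ hk', mul_div_assoc', le_div_iff₀ (hσ _)]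
        have h2 := hnext' i (A' i)
        calc ((bunch G (A' i) (A' (i + 1))).ncard : ℝ) * σ (i + 1)
            ≤ ((bunch G (A' i) (A' (i + 1))).ncard : ℝ) * ⌈σ (i + 1)⌉₊ := by
              gcongr
              exact Nat.le_ceil _
          _ ≤ 2 * (#(A' i) : ℝ) ^ 2 := h2
          _ ≤ 2 * (2 * σ i) ^ 2 := by gcongr
          _ = 8 * σ i ^ 2 := by ring
      · obtain rfl : i + 1 = k := by omega
        have h2 : ((bunch G (A' i) (A (i + 1))).ncard : ℝ) ≤ (#(A' i) : ℝ) ^ 2 := by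
          exact_mod_cast ncard_bunch_le_sq G _ _
        have h3 : σ i ^ 2 ≤ σ i ^ 2 / σ (i + 1) := by
          rw [le_div_iff₀ (hσ _)]
          nlinarith [sq_nonneg (σ i)]
        have h4 : (#(A' i) : ℝ) ^ 2 ≤ (2 * σ i) ^ 2 := by gcongr
        nlinarith [sq_nonneg (σ i)]

/-- The exponents of the base of the path lengths `q ^ c i` in the sizes of the levels. -/
def lengthExp (c : ℕ → ℕ) : ℕ → ℕ
  | 0 => 0
  | i + 1 => 2 * lengthExp c i + c i

/-- The sizes `n q ^ b i / (x ^ a i * γ ^ 2)` with `a (i + 1) = 2 a i + 1` and `b (i + 1) = 2 b i +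
c i` make `σ i ^ 2 / σ (i + 1)` equal to `n x / (γ ^ 2 q ^ c i)` on every level. The factor `q ^ c
i` leaves room for paths of that length, and `γ ^ 2` for path buying. -/
theorem exists_hierarchy [Fintype V] {G : SimpleGraph V} {γ : ℕ} (hγ : 1 ≤ γ)
    (hG : ((2 * γ + 1 : ℕ) : ℕ∞) ≤ G.egirth) (k : ℕ) (hk : 1 ≤ k) (hV : 1 ≤ Fintype.card V)
    (q : ℝ) (hq : 1 ≤ q) (c : ℕ → ℕ) (x : ℝ) (hx : 1 ≤ x)
    (hxk : x ^ ((γ + 1) * 2 ^ k - 1) = Fintype.card V * q ^ lengthExp c k) :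
    ∃ A : ℕ → Finset V, A k = ∅ ∧
      ((sparseEdges G (A 0) γ).ncard : ℝ) ≤ 32 * (Fintype.card V * x) ∧
      ∀ i < k, (γ : ℝ) ^ 2 * q ^ c i * (bunch G (A i) (A (i + 1))).ncard ≤
        8 * (Fintype.card V * x) := by
  have hγ0 : (0 : ℝ) < γ := by exact_mod_cast hγ
  have hγ1 : (1 : ℝ) ≤ γ := by exact_mod_cast hγ
  have hn0 : (0 : ℝ) < Fintype.card V := by exact_mod_cast hV
  have hq0 : 0 < q := by linarith
  have hx0 : 0 < x := by linarith
  set n : ℝ := (Fintype.card V : ℝ)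
  set a : ℕ → ℕ := fun i ↦ (γ + 1) * 2 ^ i - 1 with ha
  set b := lengthExp c
  have hb : ∀ i, b (i + 1) = 2 * b i + c i := fun i ↦ rfl
  have haS : ∀ i, a (i + 1) = 2 * a i + 1 := by
    intro i
    have : 1 ≤ (γ + 1) * 2 ^ i := Nat.mul_pos (by omega) (by positivity)
    simp only [ha, pow_succ, ← mul_assoc]
    omega
  set σ : ℕ → ℝ := fun i ↦ n * q ^ b i / (x ^ a i * γ ^ 2) with hσ
  have hσ0 : ∀ i, 0 < σ i := fun i ↦ by positivity
  have hσS : ∀ i, γ ^ 2 * q ^ c i * (8 * (σ i ^ 2 / σ (i + 1))) = 8 * (n * x) := by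
    intro i
    simp only [hσ, haS, hb, pow_add, pow_mul']
    field_simp
  obtain ⟨A, hA, hA0, hAi⟩ := exists_levels hγ hG k hk (4 * x) (by linarith) σ hσ0
    (by
      simp only [hσ, ha, hxk]
      rw [div_le_one (by positivity)]
      exact le_mul_of_one_le_right (by positivity) (one_le_pow₀ hγ1))
    -- The factor `4` in `ρ = 4 x` absorbs the `γ ^ 2` in the level sizes, as `γ ^ 2 ≤ 4 ^ γ`.
    (by
      have h1 : (γ : ℝ) ^ 2 ≤ 4 ^ γ := by
        have : (γ : ℝ) ≤ 2 ^ γ := by exact_mod_cast Nat.lt_two_pow_self.le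
        calc (γ : ℝ) ^ 2 ≤ (2 ^ γ) ^ 2 := by gcongr
          _ = 4 ^ γ := by rw [← pow_mul, mul_comm, pow_mul]; norm_num
      have h2 : b 0 = 0 := rfl
      have h3 : a 0 = γ := by simp [ha]
      simp only [hσ, h2, h3, pow_zero, mul_one, mul_pow]
      rw [div_mul_eq_mul_div, le_div_iff₀ (by positivity)]
      calc n * (x ^ γ * γ ^ 2) ≤ n * (x ^ γ * 4 ^ γ) := by gcongr
        _ = _ := by ring)
  refine ⟨A, hA, by linarith, fun i hi ↦ ?_⟩
  rw [← hσS i]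
  gcongr
  exact hAi i hi

end Levels

/-! ### Path buying -/

section PathBuying

open Finset

variable {V : Type u}

lemma within_of_adj_succ {H : SimpleGraph V} (z : ℕ → V) {i j : ℕ} (hij : i ≤ j)
    (h : ∀ l, i ≤ l → l < j → H.Adj (z l) (z (l + 1))) : Within H (j - i) (z i) (z j) := by
  induction j, hij using Nat.le_induction with
  | base => exact .refl _ _ _
  | succ j hj ih =>
    exact ((ih fun l hl hlj ↦ h l hl (by omega)).trans
      (.of_adj (h j hj (by omega)))).mono (by omega)

/-- The pairs in `P` with additive stretch at most `j` in `H`, for small `j`. -/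
def boughtPairs (G H : SimpleGraph V) (P : Set (V × V)) (M : ℕ) : Set ((V × V) × ℕ) :=
  {t | t.1 ∈ P ∧ t.2 < M ∧ Within H (G.dist t.1.1 t.1.2 + t.2) t.1.1 t.1.2}

lemma boughtPairs_subset (G H : SimpleGraph V) (P : Set (V × V)) (M : ℕ) :
    boughtPairs G H P M ⊆ P ×ˢ Set.Iio M := fun _ ht ↦ ⟨ht.1, ht.2.1⟩

lemma finite_boughtPairs [Finite V] (G H : SimpleGraph V) (P : Set (V × V)) (M : ℕ) :
    (boughtPairs G H P M).Finite :=
  ((Set.toFinite P).prod (Set.finite_Iio M)).subset (boughtPairs_subset G H P M)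

lemma boughtPairs_mono {G H H' : SimpleGraph V} (h : H ≤ H') (P : Set (V × V)) (M : ℕ) :
    boughtPairs G H P M ⊆ boughtPairs G H' P M := fun _ ht ↦ ⟨ht.1, ht.2.1, ht.2.2.of_le h⟩

/-- The missing edges of a shortest path are charged to improved distances between cluster centres.
A ball of radius `γ` meets a shortest path in at most `2 γ + 1` vertices, so many missing edges
involve many centres. Each of these centres gets closer to the first or to the last one, since
otherwise a route through it would already have stretch `6 γ`. -/
theorem exists_buy_path [Finite V] {G H : SimpleGraph V} (hle : H ≤ G) {γ : ℕ} (c : V → V)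
    (hc : ∀ u v, G.Adj u v → ¬ H.Adj u v → Within H γ u (c u)) (P : Set (V × V)) {u v : V}
    (huv : G.Reachable u v)
    (hP : ∀ x y, Within G (G.dist u v) u x → Within G (G.dist u v) x y → Within G γ x (c x) →
      Within G γ y (c y) → c x ≠ c y → (c x, c y) ∈ P)
    (hfail : ¬ Within H (G.dist u v + 6 * γ) u v) :
    ∃ H', H < H' ∧ H' ≤ G ∧ H'.edgeSet.ncard + 2 * (2 * γ + 1) *
        (boughtPairs G H P (4 * γ + 1)).ncard ≤ H.edgeSet.ncard +
          2 * (2 * γ + 1) * (boughtPairs G H' P (4 * γ + 1)).ncard := by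
  classical
  obtain ⟨p, hp⟩ := huv.exists_walk_length_eq_dist
  set L := G.dist u v with hL
  set z : ℕ → V := p.getVert with hz
  have hz0 : z 0 = u := p.getVert_zero
  have hzL : z L = v := by rw [hz, ← hp, p.getVert_length]
  have hzG : ∀ i < L, G.Adj (z i) (z (i + 1)) := fun i hi ↦ p.adj_getVert_succ (by omega)
  have hzw : ∀ i j, i ≤ j → Within G (j - i) (z i) (z j) := fun i j hij ↦ within_getVert p hij
  have hzd : ∀ i j, i ≤ j → j ≤ L → j - i ≤ G.dist (z i) (z j) := by
    intro i j hij hj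
    have h1 := ((hz0 ▸ hzw 0 i (Nat.zero_le i)).trans
      (within_dist (hzw i j hij).reachable)).trans (hzL ▸ hzw j L hj) |>.dist_le
    omega
  set M : Finset ℕ := {i ∈ range L | ¬ H.Adj (z i) (z (i + 1))} with hM
  have hML : ∀ i ∈ M, i < L := fun i hi ↦ mem_range.1 (mem_filter.1 hi).1
  have hMne : M.Nonempty := by
    by_contra hne
    refine hfail (Within.mono (hzL ▸ hz0 ▸
      within_of_adj_succ z (H := H) (Nat.zero_le L) fun l _ hl ↦ ?_) (by omega))
    by_contra h
    exact hne ⟨l, mem_filter.2 ⟨mem_range.2 hl, h⟩⟩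
  have hcl : ∀ i ∈ M, Within H γ (z i) (c (z i)) := fun i hi ↦
    hc _ _ (hzG i (hML i hi)) (mem_filter.1 hi).2
  have hcr : ∀ i ∈ M, Within H γ (z (i + 1)) (c (z (i + 1))) := fun i hi ↦
    hc _ _ (hzG i (hML i hi)).symm fun h ↦ (mem_filter.1 hi).2 h.symm
  set E : Set (Sym2 V) := (fun i ↦ s(z i, z (i + 1))) '' (M : Set ℕ) with hE
  set H' := H ⊔ SimpleGraph.fromEdgeSet E with hH'
  have hHH' : H ≤ H' := le_sup_left
  have hMadj : ∀ i ∈ M, H'.Adj (z i) (z (i + 1)) := by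
    intro i hi
    rw [hH', SimpleGraph.sup_adj, SimpleGraph.fromEdgeSet_adj]
    exact .inr ⟨⟨i, hi, rfl⟩, (hzG i (hML i hi)).ne⟩
  have hH'z : ∀ i < L, H'.Adj (z i) (z (i + 1)) := by
    intro i hi
    by_cases h : H.Adj (z i) (z (i + 1))
    · exact hHH' h
    · exact hMadj i (mem_filter.2 ⟨mem_range.2 hi, h⟩)
  have hH'G : H' ≤ G := by
    refine sup_le hle ?_
    intro a b hab
    rw [SimpleGraph.fromEdgeSet_adj] at hab
    obtain ⟨i, hi, hiab⟩ := hab.1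
    rw [← SimpleGraph.mem_edgeSet, ← hiab]
    exact hzG i (hML i hi)
  have hcard : H'.edgeSet.ncard ≤ H.edgeSet.ncard + #M := by
    have h1 : H'.edgeSet ⊆ H.edgeSet ∪ E := by
      rw [hH', SimpleGraph.edgeSet_sup, SimpleGraph.edgeSet_fromEdgeSet]
      exact Set.union_subset_union_right _ Set.sdiff_subset
    refine (Set.ncard_le_ncard h1 (Set.toFinite _)).trans ((Set.ncard_union_le _ _).trans ?_)
    refine Nat.add_le_add_left ((Set.ncard_image_le (Finset.finite_toSet M)).trans ?_) _
    rw [Set.ncard_coe_finset]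
  set C : Finset V := M.image fun i ↦ c (z i) with hC
  have hfib : #M ≤ (2 * γ + 1) * #C := by
    refine card_le_mul_card_image M (2 * γ + 1) fun a ha ↦ ?_
    set F : Finset ℕ := {i ∈ M | c (z i) = a} with hF
    rcases F.eq_empty_or_nonempty with h | h
    · simp [h]
    · have h1 : F ⊆ Icc (F.min' h) (F.min' h + 2 * γ) := by
        intro i hi
        have hm := mem_filter.1 (F.min'_mem h)
        have hle' := F.min'_le i hi
        replace hi := mem_filter.1 hi
        rw [mem_Icc]
        refine ⟨hle', ?_⟩
        have h2 := (hm.2 ▸ (hcl _ hm.1).of_le hle).trans ((hi.2 ▸ (hcl i hi.1).of_le hle)).symm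
        have h3 := h2.dist_le
        have h4 := hzd _ _ hle' (hML i hi.1).le
        omega
      refine (card_le_card h1).trans ?_
      rw [Nat.card_Icc]
      omega
  set i₀ := M.min' hMne
  set i₁ := M.max' hMne
  have hi₀ := M.min'_mem hMne
  have hi₁ := M.max'_mem hMne
  have hstart : Within H i₀ u (z i₀) := by
    have := within_of_adj_succ z (H := H) (Nat.zero_le i₀) fun l _ hl ↦ by
      by_contra h
      have := M.min'_le l (mem_filter.2 ⟨mem_range.2 (hl.trans (hML _ hi₀)), h⟩)
      omega
    rwa [hz0] at this
  have hend : Within H (L - (i₁ + 1)) (z (i₁ + 1)) v := by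
    have := within_of_adj_succ z (H := H) (hML _ hi₁ : i₁ + 1 ≤ L) fun l hl hlL ↦ by
      by_contra h
      have := M.le_max' l (mem_filter.2 ⟨mem_range.2 hlL, h⟩)
      omega
    rwa [hzL] at this
  -- After the purchase the two centres are within `j - i + 2 γ`, while their distance in `G` is at
  -- least `j - i - 2 γ`. The additive stretch is thus at most `4 γ`, which explains the bound `4 *
  -- γ + 1` in `boughtPairs`.
  have hgain : ∀ i j, i ≤ j → j ≤ L → Within H γ (z i) (c (z i)) → Within H γ (z j) (c (z j)) →
      ¬ Within H (j - i + 2 * γ) (c (z i)) (c (z j)) →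
      ∃ e, ((c (z i), c (z j)), e) ∈
        boughtPairs G H' P (4 * γ + 1) \ boughtPairs G H P (4 * γ + 1) := by
    intro i j hij hj hi' hj' hno
    have hiG := hi'.of_le hle
    have hjG := hj'.of_le hle
    have hiH' := hi'.of_le hHH'
    have hjH' := hj'.of_le hHH'
    have h1 : Within H' (j - i + 2 * γ) (c (z i)) (c (z j)) :=
      ((hiH'.symm.trans (within_of_adj_succ z hij fun l _ hl ↦ hH'z l (by omega))).trans
        hjH').mono (by omega)
    have h2 := (h1.of_le hH'G).dist_le
    have h3 := ((hiG.trans (within_dist (h1.of_le hH'G).reachable)).trans hjG.symm).dist_le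
    have h4 := hzd i j hij hj
    have hne : c (z i) ≠ c (z j) := fun h ↦ hno (h ▸ .refl _ _ _)
    have hPm : (c (z i), c (z j)) ∈ P := by
      refine hP _ _ ?_ ((hzw i j hij).mono (by omega)) hiG hjG hne
      exact hz0 ▸ ((hzw 0 i (Nat.zero_le i)).mono (by omega))
    have h5 : G.dist (c (z i)) (c (z j)) + (j - i + 2 * γ - G.dist (c (z i)) (c (z j)))
        = j - i + 2 * γ := by omega
    refine ⟨j - i + 2 * γ - G.dist (c (z i)) (c (z j)), ⟨hPm, ?_, ?_⟩, fun h ↦ hno ?_⟩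
    · dsimp only
      omega
    · rwa [h5]
    · have := h.2.2
      change Within H _ _ _ at this
      rwa [h5] at this
  set N := boughtPairs G H' P (4 * γ + 1) \ boughtPairs G H P (4 * γ + 1) with hN
  have hNfin : N.Finite := (finite_boughtPairs G H' P _).sdiff
  have hCN : (C : Set V) ⊆ (fun t ↦ t.1.1) '' N ∪ (fun t ↦ t.1.2) '' N := by
    intro a ha
    rw [hC, coe_image] at ha
    obtain ⟨i, hi, rfl⟩ := ha
    have hi0 := M.min'_le i hi
    have hi1 := M.le_max' i hi
    by_cases h1 : Within H (i - i₀ + 2 * γ) (c (z i₀)) (c (z i))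
    · by_cases h2 : Within H (i₁ + 1 - i + 2 * γ) (c (z i)) (c (z (i₁ + 1)))
      · exfalso
        have hi₁L := hML _ hi₁
        exact hfail ((((((hstart.trans (hcl _ hi₀)).trans h1).trans h2).trans
          (hcr _ hi₁).symm).trans hend).mono (by omega))
      · obtain ⟨e, he⟩ := hgain i (i₁ + 1) (by omega) (hML _ hi₁) (hcl i hi) (hcr _ hi₁) h2
        exact .inl ⟨_, he, rfl⟩
    · obtain ⟨e, he⟩ := hgain i₀ i hi0 (hML i hi).le (hcl _ hi₀) (hcl i hi) h1
      exact .inr ⟨_, he, rfl⟩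
  have hCcard : #C ≤ 2 * N.ncard := by
    rw [← Set.ncard_coe_finset, two_mul]
    refine (Set.ncard_le_ncard hCN ((hNfin.image _).union (hNfin.image _))).trans ?_
    exact (Set.ncard_union_le _ _).trans
      (add_le_add (Set.ncard_image_le hNfin) (Set.ncard_image_le hNfin))
  have hNcard : N.ncard + (boughtPairs G H P (4 * γ + 1)).ncard =
      (boughtPairs G H' P (4 * γ + 1)).ncard :=
    Set.ncard_sdiff_add_ncard_of_subset (boughtPairs_mono hHH' _ _) (finite_boughtPairs _ _ _ _)
  refine ⟨H', lt_of_le_of_ne hHH' fun h ↦ ?_, hH'G, ?_⟩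
  · exact (mem_filter.1 hi₀).2 (h ▸ hMadj _ hi₀)
  · rw [← hNcard]
    have := Nat.mul_le_mul_left (2 * γ + 1) hCcard
    nlinarith

/-- Additive stretch `6 γ` by buying shortest paths. -/
theorem exists_path_buying [Finite V] {G H₀ : SimpleGraph V} (hle : H₀ ≤ G) {γ : ℕ} (hγ : 1 ≤ γ)
    (c : V → V) (hc : ∀ u v, G.Adj u v → ¬ H₀.Adj u v → Within H₀ γ u (c u)) (P : Set (V × V))
    (Q : V → V → Prop)
    (hQ : ∀ u v, Q u v → G.Reachable u v → ∀ x y, Within G (G.dist u v) u x →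
      Within G (G.dist u v) x y → Within G γ x (c x) → Within G γ y (c y) → c x ≠ c y →
      (c x, c y) ∈ P) :
    ∃ H, H₀ ≤ H ∧ H ≤ G ∧
      H.edgeSet.ncard ≤ H₀.edgeSet.ncard + 30 * γ ^ 2 * P.ncard ∧
      ∀ u v, Q u v → G.Reachable u v → Within H (G.dist u v + 6 * γ) u v := by
  classical
  -- A potential argument: in a maximal graph whose added edges are paid for by bought triples, no
  -- admissible pair can fail, because buying its path would preserve the inequality.
  set 𝓗 : Set (SimpleGraph V) := {H | H₀ ≤ H ∧ H ≤ G ∧ H.edgeSet.ncard ≤ H₀.edgeSet.ncard +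
    2 * (2 * γ + 1) * (boughtPairs G H P (4 * γ + 1)).ncard} with h𝓗
  obtain ⟨H, hH⟩ := (Set.toFinite 𝓗).exists_maximal ⟨H₀, le_rfl, hle, by omega⟩
  refine ⟨H, hH.prop.1, hH.prop.2.1, hH.prop.2.2.trans ?_, fun u v huv hr ↦ ?_⟩
  · refine Nat.add_le_add_left ?_ _
    have h1 := Set.ncard_le_ncard (boughtPairs_subset G H P (4 * γ + 1))
      ((Set.toFinite P).prod (Set.finite_Iio _))
    rw [Set.ncard_prod, ← coe_Iio, Set.ncard_coe_finset, Nat.card_Iio] at h1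
    calc 2 * (2 * γ + 1) * (boughtPairs G H P (4 * γ + 1)).ncard
        ≤ 2 * (2 * γ + 1) * (P.ncard * (4 * γ + 1)) := by gcongr
      _ = 2 * (2 * γ + 1) * (4 * γ + 1) * P.ncard := by ring
      _ ≤ 30 * γ ^ 2 * P.ncard := by
        refine Nat.mul_le_mul_right _ ?_
        nlinarith
  · by_contra hfail
    obtain ⟨H', hlt, hH'G, hcard⟩ := exists_buy_path hH.prop.2.1 c
      (fun a b hab hab' ↦ (hc a b hab fun h ↦ hab' (hH.prop.1 h)).of_le hH.prop.1) P hr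
      (hQ u v huv hr) hfail
    refine hlt.not_ge (hH.le_of_ge ⟨hH.prop.1.trans hlt.le, hH'G, ?_⟩ hlt.le)
    have := hH.prop.2.2
    omega

end PathBuying

/-! ### Iterating over the levels -/

section Iterate

variable {V : Type u}

/-- The distances `l`, additive errors `e` and radii `R` of the levels `i₀, …, K`. -/
structure Schedule (i₀ K : ℕ) (q l e R : ℕ → ℕ) : Prop where
  length_succ : ∀ i, i₀ ≤ i → i < K → l (i + 1) = q i * l i
  complete : ∀ i, i₀ ≤ i → i < K → q i * e i ≤ e (i + 1)
  incomplete : ∀ i, i₀ ≤ i → i < K → (q i - 1) * e i + 4 * R i ≤ e (i + 1)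
  radius : ∀ i, i₀ ≤ i → i < K → l (i + 1) + 3 * R i ≤ R (i + 1)

lemma Schedule.dichotomy {i₀ K : ℕ} {q l e R : ℕ → ℕ} (hS : Schedule i₀ K q l e R)
    {G : SimpleGraph V} {T : ℕ → V → V → Prop} (hT : DistRel T) {A : ℕ → Finset V}
    (hA : ∀ i ≤ K, ∀ x n, Meets G (A i) n x → ∃ a ∈ A i, Within G n x a ∧ T n x a)
    (hAA : ∀ i, i₀ ≤ i → i < K → ∀ a ∈ A i, ∀ b ∈ A i, ∀ n ≤ l (i + 1) + 2 * R i, Within G n a b →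
      T n a b ∨ Meets G (A (i + 1)) n a ∧ Meets G (A (i + 1)) n b)
    (h0 : Dichotomy G T (A i₀) (l i₀) (e i₀) (R i₀)) {i : ℕ} (hi₀ : i₀ ≤ i) (hi : i ≤ K) :
    Dichotomy G T (A i) (l i) (e i) (R i) := by
  induction i, hi₀ using Nat.le_induction with
  | base => exact h0
  | succ i hi₀ ih =>
    have h := Dichotomy.step hT (A' := A (i + 1)) (e' := e (i + 1)) (q i) (ih (by omega))
      (hA i (by omega))
      (fun a ha b hb n hn hab ↦ hAA i hi₀ (by omega) a ha b hb n
        (by rw [hS.length_succ i hi₀ (by omega)]; exact hn) hab)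
      (hS.complete i hi₀ (by omega)) (hS.incomplete i hi₀ (by omega))
    rw [← hS.length_succ i hi₀ (by omega)] at h
    exact h.mono hT le_rfl le_rfl (hS.radius i hi₀ (by omega))

/-- With `A' = ∅` the second alternative of the dichotomy is impossible. -/
lemma Dichotomy.of_top {G : SimpleGraph V} {T : ℕ → V → V → Prop} (hT : DistRel T)
    {A : Finset V} {l e R : ℕ} (h : Dichotomy G T A l e R) (q e' : ℕ)
    (hA : ∀ x n, Meets G A n x → ∃ a ∈ A, Within G n x a ∧ T n x a)
    (hAA : ∀ a ∈ A, ∀ b ∈ A, ∀ n ≤ q * l + 2 * R, Within G n a b → T n a b)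
    (he : q * e ≤ e') (he' : (q - 1) * e + 4 * R ≤ e') {x y : V} {d : ℕ} (hd : d ≤ q * l)
    (hxy : Within G d x y) : T (d + e') x y := by
  have := Dichotomy.step hT (A' := ∅) (e' := e') q h hA
    (fun a ha b hb n hn hab ↦ .inl (hAA a ha b hb n hn hab)) he he' x y d hd hxy
  refine this.resolve_right fun h ↦ ?_
  obtain ⟨a, ha, -⟩ := h.1
  simp at ha

end Iterate

/-! ### Emulators from a hierarchy -/

section EmulatorConstruction

variable {V : Type u}

/-- The weight of an edge is the distance in `G` of its endpoints. -/
noncomputable def distWeight (G : SimpleGraph V) : Sym2 V → ℝ≥0 :=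
  Sym2.lift ⟨fun x y ↦ (G.dist x y : ℝ≥0), fun _ _ ↦ congrArg Nat.cast G.dist_comm⟩

/-- There is a walk of weight at most `n`. -/
def WithinWeight (H : SimpleGraph V) (w : Sym2 V → ℝ≥0) (n : ℕ) (x y : V) : Prop :=
  ∃ p : H.Walk x y, walkWeight w p ≤ n

lemma distRel_withinWeight (H : SimpleGraph V) (w : Sym2 V → ℝ≥0) :
    DistRel (WithinWeight H w) where
  refl x := ⟨.nil, by simp [walkWeight]⟩
  symm := by
    rintro n x y ⟨p, hp⟩
    exact ⟨p.reverse, by simpa [walkWeight, List.sum_reverse] using hp⟩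
  trans := by
    rintro m n x y z ⟨p, hp⟩ ⟨q, hq⟩
    refine ⟨p.append q, ?_⟩
    simp only [walkWeight, SimpleGraph.Walk.edges_append, List.map_append, List.sum_append,
      Nat.cast_add]
    exact add_le_add hp hq
  mono := by
    rintro m n x y ⟨p, hp⟩ hmn
    exact ⟨p, hp.trans (by exact_mod_cast hmn)⟩

lemma WithinWeight.weightedDist_le {H : SimpleGraph V} {w : Sym2 V → ℝ≥0} {n : ℕ} {x y : V}
    (h : WithinWeight H w n x y) : weightedDist H w x y ≤ n := by
  obtain ⟨p, hp⟩ := h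
  exact (iInf_le _ p).trans (by exact_mod_cast hp)

lemma edist_le_walkWeight {G H : SimpleGraph V} (hH : ∀ x y, H.Adj x y → G.Reachable x y)
    {x y : V} (p : H.Walk x y) :
    (G.edist x y : ℝ≥0∞) ≤ (walkWeight (distWeight G) p : ℝ≥0∞) := by
  induction p with
  | nil => simp
  | @cons x y z h p ih =>
    have h1 : (G.edist x z : ℝ≥0∞) ≤ (G.edist x y : ℝ≥0∞) + (G.edist y z : ℝ≥0∞) := by
      rw [← ENat.toENNReal_add]
      exact ENat.toENNReal_le.2 G.edist_triangle
    have h2 : walkWeight (distWeight G) (SimpleGraph.Walk.cons h p) =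
        (G.dist x y : ℝ≥0) + walkWeight (distWeight G) p := by
      simp [walkWeight, distWeight]
    rw [h2, ENNReal.coe_add]
    refine h1.trans (add_le_add ?_ ih)
    rw [← (hH x y h).coe_dist_eq_edist]
    simp

/-- Weighting edges by distances in `G` rules out contraction. Quantifying over all `T` reduces the
upper bound to the formal laws of distances, so the induction on levels applies unchanged. -/
theorem exists_emulator_of_edges [Finite V] (G : SimpleGraph V) (E : Set (Sym2 V))
    (hE : ∀ x y, s(x, y) ∈ E → G.Reachable x y) (f : ℕ → ℝ)
    (h : ∀ T, DistRel T → (∀ x y, s(x, y) ∈ E → T (G.dist x y) x y) →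
      ∀ x y, G.Reachable x y → ∃ n : ℕ, T n x y ∧ (n : ℝ) ≤ f (G.dist x y)) :
    ∃ 𝓔 : Emulator G f, 𝓔.size ≤ E.ncard := by
  set H := SimpleGraph.fromEdgeSet E with hH
  have hadj : ∀ x y, H.Adj x y → G.Reachable x y := fun x y hxy ↦
    hE x y ((SimpleGraph.fromEdgeSet_adj _).1 hxy).1
  have hT := distRel_withinWeight H (distWeight G)
  refine ⟨⟨V, inferInstance, .refl V, H, distWeight G, ?_, ?_, ?_⟩, ?_⟩
  · intro e
    induction e with
    | _ x y =>
      intro he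
      have hxy : H.Adj x y := he
      simpa [distWeight] using (hadj x y hxy).pos_dist_of_ne hxy.ne
  · exact fun x y ↦ le_iInf fun p ↦ edist_le_walkWeight hadj p
  · intro x y hxy
    obtain ⟨n, hn, hnf⟩ := h _ hT (fun a b hab ↦ by
      rcases eq_or_ne a b with rfl | hne
      · exact hT.mono (hT.refl _) (Nat.zero_le _)
      · refine ⟨SimpleGraph.Adj.toWalk ((SimpleGraph.fromEdgeSet_adj _).2 ⟨hab, hne⟩), ?_⟩
        simp [walkWeight, distWeight]) x y hxy
    refine hn.weightedDist_le.trans ?_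
    rw [← ENNReal.ofReal_natCast]
    exact ENNReal.ofReal_le_ofReal hnf
  · refine Set.ncard_le_ncard ?_ (Set.toFinite _)
    change H.edgeSet ⊆ E
    rw [hH, SimpleGraph.edgeSet_fromEdgeSet]
    exact Set.sdiff_subset

lemma exists_pivots [Finite V] (G : SimpleGraph V) (A : Finset V) :
    ∃ E : Set (Sym2 V), E.ncard ≤ Nat.card V ∧ (∀ x y, s(x, y) ∈ E → G.Reachable x y) ∧
      ∀ x n, Meets G A n x → ∃ a ∈ A, Within G n x a ∧ s(x, a) ∈ E ∧ G.dist x a ≤ n := by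
  classical
  have h : ∀ x, ∃ a, G.Reachable x a ∧
      ∀ n, Meets G A n x → a ∈ A ∧ Within G n x a := by
    intro x
    by_cases hx : ∃ n, Meets G A n x
    · obtain ⟨a, ha, hxa⟩ := Nat.find_spec hx
      exact ⟨a, hxa.reachable, fun n hn ↦ ⟨ha, hxa.mono (Nat.find_min' hx hn)⟩⟩
    · exact ⟨x, .refl _, fun n hn ↦ absurd ⟨n, hn⟩ hx⟩
  choose p hp hp' using h
  refine ⟨Set.range fun x ↦ s(x, p x), ?_, ?_, ?_⟩
  · rw [← Set.image_univ, ← Set.ncard_univ]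
    exact Set.ncard_image_le
  · rintro x y ⟨z, hz⟩
    rcases Sym2.eq_iff.1 hz with ⟨rfl, rfl⟩ | ⟨rfl, rfl⟩
    · exact hp _
    · exact (hp _).symm
  · exact fun x n hn ↦
      ⟨p x, (hp' x n hn).1, (hp' x n hn).2, ⟨x, rfl⟩, (hp' x n hn).2.dist_le⟩

lemma sparseEdges_dichotomy {G : SimpleGraph V} {T : ℕ → V → V → Prop} (hT : DistRel T)
    (A : Finset V) (γ : ℕ) (h : ∀ x y, s(x, y) ∈ sparseEdges G A γ → T 1 x y) :
    Dichotomy G T A 1 0 γ := by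
  intro x y d hd hxy
  rcases Nat.eq_zero_or_pos d with rfl | hd0
  · exact .inl (within_zero_iff.1 hxy ▸ hT.refl x)
  obtain rfl : d = 1 := by omega
  by_cases hr : Meets G A γ x ∧ Meets G A γ y
  · exact .inr hr
  left
  rcases eq_or_ne x y with rfl | hne
  · exact hT.mono (hT.refl x) (Nat.zero_le _)
  have hadj : G.Adj x y := by
    rw [← SimpleGraph.dist_eq_one_iff_adj]
    have := hxy.dist_le
    have := hxy.reachable.pos_dist_of_ne hne
    omega
  refine h x y ⟨hadj, ?_⟩
  by_cases hx : Meets G A γ x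
  · exact ⟨y, Sym2.mem_mk_right _ _, fun hy ↦ hr ⟨hx, hy⟩⟩
  · exact ⟨x, Sym2.mem_mk_left _ _, hx⟩

lemma bunch_dichotomy {G : SimpleGraph V} {T : ℕ → V → V → Prop} (hT : DistRel T)
    {A A' : Finset V} {n : ℕ} (h : ∀ p ∈ bunch G A A', ∀ n' ≤ n, Within G n' p.1 p.2 → T n' p.1 p.2)
    {a b : V} (ha : a ∈ A) (hb : b ∈ A) (hab : Within G n a b) :
    T n a b ∨ Meets G A' n a ∧ Meets G A' n b := by
  rcases eq_or_ne a b with rfl | hne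
  · exact .inl (hT.mono (hT.refl a) (Nat.zero_le _))
  by_cases h1 : Meets G A' (G.dist a b) a
  · by_cases h2 : Meets G A' (G.dist b a) b
    · exact .inr ⟨h1.mono hab.dist_le, h2.mono hab.symm.dist_le⟩
    · exact .inl (hT.symm (h (b, a) ⟨hb, ha, hne.symm, hab.symm.reachable, h2⟩ n le_rfl hab.symm))
  · exact .inl (h (a, b) ⟨ha, hb, hne, hab.reachable, h1⟩ n le_rfl hab)

/-- The emulator of a hierarchy of levels `A 0, …, A K`. -/
theorem exists_emulator_of_levels [Finite V] (G : SimpleGraph V) (γ K : ℕ) (A : ℕ → Finset V)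
    (hAK : A (K + 1) = ∅) (f : ℕ → ℝ)
    (hf : ∀ d : ℕ, ∃ q l e R, Schedule 0 K q l e R ∧ l 0 = 1 ∧ R 0 = γ ∧
      ∃ Q e' : ℕ, d ≤ Q * l K ∧ Q * e K ≤ e' ∧ (Q - 1) * e K + 4 * R K ≤ e' ∧
        ((d + e' : ℕ) : ℝ) ≤ f d) :
    ∃ 𝓔 : Emulator G f, 𝓔.size ≤ (sparseEdges G (A 0) γ).ncard + (K + 1) * Nat.card V +
      ∑ i ∈ Finset.range (K + 1), (bunch G (A i) (A (i + 1))).ncard := by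
  choose E hE hEr hEp using fun i ↦ exists_pivots G (A i)
  set F : ℕ → Set (Sym2 V) := fun i ↦ (fun p ↦ s(p.1, p.2)) '' bunch G (A i) (A (i + 1)) with hF
  set D : Set (Sym2 V) := sparseEdges G (A 0) γ ∪ (⋃ i ∈ Finset.range (K + 1), E i) ∪
    ⋃ i ∈ Finset.range (K + 1), F i with hD
  have hcard : D.ncard ≤ (sparseEdges G (A 0) γ).ncard + (K + 1) * Nat.card V +
      ∑ i ∈ Finset.range (K + 1), (bunch G (A i) (A (i + 1))).ncard := by
    refine (Set.ncard_union_le _ _).trans (add_le_add ((Set.ncard_union_le _ _).trans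
      (Nat.add_le_add_left ?_ _)) ?_)
    · refine (Finset.set_ncard_biUnion_le _ _).trans ?_
      refine (Finset.sum_le_card_nsmul _ _ _ fun i _ ↦ hE i).trans ?_
      rw [Finset.card_range, smul_eq_mul]
    · refine (Finset.set_ncard_biUnion_le _ _).trans (Finset.sum_le_sum fun i _ ↦ ?_)
      exact Set.ncard_image_le
  obtain ⟨𝓔, h𝓔⟩ := exists_emulator_of_edges G D (fun x y hxy ↦ by
    rcases hxy with (h | h) | h
    · exact SimpleGraph.Adj.reachable h.1
    · simp only [Set.mem_iUnion] at h
      obtain ⟨i, -, h⟩ := h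
      exact hEr i x y h
    · simp only [Set.mem_iUnion] at h
      obtain ⟨i, -, p, hp, hpe⟩ := h
      rcases Sym2.eq_iff.1 hpe with ⟨rfl, rfl⟩ | ⟨rfl, rfl⟩
      · exact hp.2.2.2.1
      · exact hp.2.2.2.1.symm) f (by
    intro T hT hTD x y hxy
    -- The emulator is already fixed here; the schedule is chosen for the distance of this pair.
    obtain ⟨q, l, e, R, hS, hl0, hR0, Q, e', hdQ, he', he'', hf⟩ := hf (G.dist x y)
    refine ⟨_, ?_, hf⟩
    have hbase : Dichotomy G T (A 0) (l 0) (e 0) (R 0) := by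
      rw [hl0, hR0]
      refine (sparseEdges_dichotomy hT (A 0) γ fun x y hxy ↦ ?_).mono hT le_rfl (Nat.zero_le _)
        le_rfl
      have := hTD x y (.inl (.inl hxy))
      rwa [SimpleGraph.dist_eq_one_iff_adj.2 hxy.1] at this
    have hA : ∀ i ≤ K, ∀ x n, Meets G (A i) n x → ∃ a ∈ A i, Within G n x a ∧ T n x a := by
      intro i hi x n hx
      obtain ⟨a, ha, hxa, hxE, hd⟩ := hEp i x n hx
      refine ⟨a, ha, hxa, hT.mono (hTD x a (.inl (.inr ?_))) hd⟩
      exact Set.mem_biUnion (Finset.mem_range.2 (by omega)) hxE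
    have hAA : ∀ i ≤ K, ∀ a ∈ A i, ∀ b ∈ A i, ∀ n, Within G n a b →
        T n a b ∨ Meets G (A (i + 1)) n a ∧ Meets G (A (i + 1)) n b := by
      intro i hi a ha b hb n hab
      refine bunch_dichotomy hT (fun p hp n' _ hpn ↦ ?_) ha hb hab
      refine hT.mono (hTD _ _ (.inr ?_)) hpn.dist_le
      exact Set.mem_biUnion (Finset.mem_range.2 (by omega)) ⟨p, hp, rfl⟩
    have htop := hS.dichotomy hT hA (fun i _ hi a ha b hb n _ ↦ hAA i hi.le a ha b hb n) hbase
      (Nat.zero_le K) le_rfl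
    refine htop.of_top hT Q e' (hA K le_rfl) (fun a ha b hb n _ hab ↦ ?_) he' he'' hdQ
      (within_dist hxy)
    refine (hAA K le_rfl a ha b hb n hab).resolve_right fun h ↦ ?_
    obtain ⟨a', ha', -⟩ := h.1
    simp [hAK] at ha')
  exact ⟨𝓔, h𝓔.trans hcard⟩

end EmulatorConstruction

/-! ### Spanners from a hierarchy -/

section SpannerConstruction

variable {V : Type u}

lemma edgeSet_fromEdgeSet_of_subset {G : SimpleGraph V} {E : Set (Sym2 V)} (h : E ⊆ G.edgeSet) :
    (SimpleGraph.fromEdgeSet E).edgeSet = E := by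
  rw [SimpleGraph.edgeSet_fromEdgeSet, sdiff_eq_left, Set.disjoint_left]
  exact fun e he ↦ G.not_isDiag_of_mem_edgeSet (h he)

/-- Each vertex keeps one edge towards a neighbour closer to `A`; following these edges gives a
shortest path to `A`. -/
lemma exists_forest [Finite V] (G : SimpleGraph V) (A : Finset V) :
    ∃ E ⊆ G.edgeSet, E.ncard ≤ Nat.card V ∧
      ∀ n x, Meets G A n x → Meets (SimpleGraph.fromEdgeSet E) A n x := by
  classical
  have h : ∀ x, ∃ y, ∀ n, Meets G A (n + 1) x → ¬ Meets G A n x →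
      G.Adj x y ∧ Meets G A n y := by
    intro x
    by_cases hx : ∃ n, Meets G A (n + 1) x ∧ ¬ Meets G A n x
    · obtain ⟨n, ⟨a, ha, p, hp⟩, hn'⟩ := hx
      cases p with
      | nil => exact absurd ⟨_, ha, .refl _ _ _⟩ hn'
      | @cons _ y _ hy p =>
        refine ⟨y, fun m hm hm' ↦ ⟨hy, a, ha, p, ?_⟩⟩
        rw [SimpleGraph.Walk.length_cons] at hp
        have : n ≤ m := by
          by_contra hlt
          exact hn' (hm.mono (by omega))
        omega
    · push Not at hx
      exact ⟨x, fun n hn hn' ↦ absurd (hx n hn) hn'⟩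
  choose p hp using h
  set S : Set V := {x | ∃ n, Meets G A (n + 1) x ∧ ¬ Meets G A n x}
  set E : Set (Sym2 V) := (fun x ↦ s(x, p x)) '' S with hE
  have hEG : E ⊆ G.edgeSet := by
    rintro _ ⟨x, ⟨n, hn, hn'⟩, rfl⟩
    exact (hp x n hn hn').1
  refine ⟨E, hEG, ?_, fun n ↦ ?_⟩
  · refine (Set.ncard_image_le (Set.toFinite _)).trans ?_
    rw [← Set.ncard_univ]
    exact Set.ncard_le_ncard (Set.subset_univ _) (Set.toFinite _)
  · induction n with
    | zero =>
      rintro x ⟨a, ha, hxa⟩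
      obtain rfl := within_zero_iff.1 hxa
      exact ⟨x, ha, .refl _ _ _⟩
    | succ n ih =>
      intro x hx
      by_cases hx' : Meets G A n x
      · exact (ih x hx').mono (Nat.le_succ n)
      · obtain ⟨hadj, hm⟩ := hp x n hx hx'
        have hE' : (SimpleGraph.fromEdgeSet E).Adj x (p x) :=
          (SimpleGraph.fromEdgeSet_adj _).2 ⟨⟨x, ⟨n, hx, hx'⟩, rfl⟩, hadj.ne⟩
        exact ((ih _ hm).trans (.of_adj hE')).mono (by omega)

lemma exists_short_paths [Finite V] (G : SimpleGraph V) (P : Set (V × V)) (L : ℕ) :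
    ∃ E ⊆ G.edgeSet, E.ncard ≤ L * P.ncard ∧
      ∀ p ∈ P, ∀ n ≤ L, Within G n p.1 p.2 → Within (SimpleGraph.fromEdgeSet E) n p.1 p.2 := by
  classical
  have h : ∀ p : V × V, ∃ E ⊆ G.edgeSet, E.ncard ≤ L ∧
      ∀ n ≤ L, Within G n p.1 p.2 → Within (SimpleGraph.fromEdgeSet E) n p.1 p.2 := by
    intro p
    by_cases hr : Within G L p.1 p.2
    · obtain ⟨w, hw⟩ := hr.reachable.exists_walk_length_eq_dist
      have hwG : {e | e ∈ w.edges} ⊆ G.edgeSet := fun e he ↦ w.edges_subset_edgeSet he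
      refine ⟨{e | e ∈ w.edges}, hwG, ?_, fun n _ hn ↦ ?_⟩
      · have : {e | e ∈ w.edges} = (w.edges.toFinset : Set (Sym2 V)) := by ext; simp
        rw [this, Set.ncard_coe_finset]
        refine (List.toFinset_card_le _).trans ?_
        rw [w.length_edges, hw]
        exact hr.dist_le
      · refine ⟨w.transfer _ fun e he ↦ ?_, ?_⟩
        · rw [edgeSet_fromEdgeSet_of_subset hwG]
          exact he
        · rw [SimpleGraph.Walk.length_transfer, hw]
          exact hn.dist_le
    · exact ⟨∅, Set.empty_subset _, by simp, fun n hn hw ↦ absurd (hw.mono hn) hr⟩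
  choose E hE hEc hEp using h
  have hP := Set.toFinite P
  refine ⟨⋃ p ∈ P, E p, Set.iUnion₂_subset fun p _ ↦ hE p, ?_, fun p hp n hn hw ↦ ?_⟩
  · have h1 : ⋃ p ∈ P, E p = ⋃ p ∈ hP.toFinset, E p := by simp
    rw [h1]
    refine (Finset.set_ncard_biUnion_le _ _).trans ?_
    refine (Finset.sum_le_card_nsmul _ _ _ fun p _ ↦ hEc p).trans ?_
    rw [smul_eq_mul, mul_comm, ← Set.ncard_eq_toFinset_card P hP]
  · exact (hEp p n hn hw).of_le (SimpleGraph.fromEdgeSet_mono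
      (Set.subset_biUnion_of_mem (u := fun p ↦ E p) hp))

/-- A subgraph of additive stretch `6 γ` for pairs at distance at most `q` that are far from the
next level. -/
theorem exists_base_spanner [Finite V] (G : SimpleGraph V) {γ : ℕ} (hγ : 1 ≤ γ)
    (A A' : Finset V) (q : ℕ) (H₀ : SimpleGraph V) (hle : H₀ ≤ G)
    (hsparse : sparseEdges G A γ ⊆ H₀.edgeSet)
    (hforest : ∀ n x, Meets G A n x → Meets H₀ A n x) :
    ∃ H, H₀ ≤ H ∧ H ≤ G ∧
      H.edgeSet.ncard ≤ H₀.edgeSet.ncard + 30 * γ ^ 2 * (bunch G A A').ncard ∧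
      Dichotomy G (Within H) A' q (6 * γ) (2 * q + 4 * γ) := by
  classical
  by_cases hA : A.Nonempty
  swap
  · have hall : G ≤ H₀ := by
      intro x y hxy
      refine hsparse ⟨hxy, x, Sym2.mem_mk_left _ _, ?_⟩
      rintro ⟨a, ha, -⟩
      exact hA ⟨a, ha⟩
    exact ⟨H₀, le_rfl, hle, by omega, fun x y d _ hxy ↦ .inl ((hxy.of_le hall).mono (by omega))⟩
  have hcenter : ∀ x, ∃ c ∈ A, Meets G A γ x → Within H₀ γ x c := by
    intro x
    by_cases hx : Meets G A γ x
    · obtain ⟨a, ha, hxa⟩ := hforest γ x hx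
      exact ⟨a, ha, fun _ ↦ hxa⟩
    · obtain ⟨a, ha⟩ := hA
      exact ⟨a, ha, fun h ↦ absurd h hx⟩
  choose c₀ hc₀A hc₀ using hcenter
  obtain ⟨H, hH₀, hHG, hcard, hH⟩ := exists_path_buying hle hγ c₀
    (fun x y hxy hxy' ↦ by
      refine hc₀ x ?_
      by_contra hx
      exact hxy' (hsparse ⟨hxy, x, Sym2.mem_mk_left _ _, hx⟩))
    (bunch G A A') (fun u v ↦ G.dist u v ≤ q ∧ ¬ Meets G A' (2 * q + 4 * γ) u)
    (by
      -- If `A'` separated the two centres it would be within `q + 2 γ` of `c₀ x`, hence within `2 q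
      -- + 3 γ` of `u`.
      rintro u v ⟨hq, hu⟩ - x y hux hxy hx hy hne
      have hxy' : Within G (γ + q + γ) (c₀ x) (c₀ y) := (hx.symm.trans (hxy.mono hq)).trans hy
      refine ⟨hc₀A x, hc₀A y, hne, hxy'.reachable, fun hm ↦ hu ?_⟩
      exact ((hm.mono hxy'.dist_le).trans ((hux.mono hq).trans hx)).mono (by omega))
  refine ⟨H, hH₀, hHG, hcard, fun x y d hd hxy ↦ ?_⟩
  have hdist := hxy.dist_le
  by_cases hx : Meets G A' (2 * q + 4 * γ) x
  · by_cases hy : Meets G A' (2 * q + 4 * γ) y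
    · exact .inr ⟨hx, hy⟩
    · left
      have := hH y x ⟨by rw [G.dist_comm]; omega, hy⟩ hxy.symm.reachable
      rw [G.dist_comm] at this
      exact this.symm.mono (by omega)
  · exact .inl ((hH x y ⟨by omega, hx⟩ hxy.reachable).mono (by omega))

theorem exists_spanner_of_within [Finite V] {G H : SimpleGraph V} (hle : H ≤ G) (f : ℕ → ℝ)
    (h : ∀ x y, G.Reachable x y → ∃ n : ℕ, Within H n x y ∧ (n : ℝ) ≤ f (G.dist x y)) :
    ∃ S : Spanner G f, S.size = H.edgeSet.ncard := by
  refine ⟨⟨H, hle, fun x y hxy ↦ ?_, fun x y hxy ↦ ?_⟩, rfl⟩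
  · obtain ⟨n, hn, -⟩ := h x y hxy
    exact hn.reachable
  · obtain ⟨n, hn, hnf⟩ := h x y hxy
    exact le_trans (by exact_mod_cast hn.dist_le) hnf

/-- The additive spanner of a single level `A`. -/
theorem exists_additive_spanner [Finite V] (G : SimpleGraph V) {γ : ℕ} (hγ : 1 ≤ γ)
    (A : Finset V) :
    ∃ S : Spanner G (fun d => (d : ℝ) + 6 * (γ : ℝ)),
      S.size ≤ (sparseEdges G A γ).ncard + Nat.card V + 30 * γ ^ 2 * (bunch G A ∅).ncard := by
  obtain ⟨E, hEG, hEc, hE⟩ := exists_forest G A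
  have hDG : sparseEdges G A γ ∪ E ⊆ G.edgeSet := Set.union_subset (fun e he ↦ he.1) hEG
  set H₀ := SimpleGraph.fromEdgeSet (sparseEdges G A γ ∪ E) with hH₀
  have hH₀e : H₀.edgeSet = sparseEdges G A γ ∪ E := edgeSet_fromEdgeSet_of_subset hDG
  have hmono : SimpleGraph.fromEdgeSet E ≤ H₀ :=
    SimpleGraph.fromEdgeSet_mono Set.subset_union_right
  -- With `A' = ∅` the range `q` does not enter the size, so it may exceed all distances.
  obtain ⟨q, hq⟩ : ∃ q, ∀ x y, G.dist x y ≤ q := by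
    cases nonempty_fintype V
    exact ⟨(Finset.univ : Finset (V × V)).sup fun p ↦ G.dist p.1 p.2, fun x y ↦
      Finset.le_sup (f := fun p : V × V ↦ G.dist p.1 p.2) (Finset.mem_univ (x, y))⟩
  obtain ⟨H, -, hHG, hcard, hH⟩ := exists_base_spanner G hγ A ∅ q H₀
    (by rw [← SimpleGraph.edgeSet_subset_edgeSet, hH₀e]; exact hDG)
    (by rw [hH₀e]; exact Set.subset_union_left)
    (fun n x hx ↦ by
      obtain ⟨a, ha, hxa⟩ := hE n x hx
      exact ⟨a, ha, hxa.of_le hmono⟩)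
  obtain ⟨S, hS⟩ := exists_spanner_of_within hHG (fun d => (d : ℝ) + 6 * (γ : ℝ))
    (fun x y hxy ↦ by
      refine ⟨_, (hH x y _ (hq x y) (within_dist hxy)).resolve_right fun h ↦ ?_, by push_cast; rfl⟩
      obtain ⟨a, ha, -⟩ := h.1
      simp at ha)
  refine ⟨S, ?_⟩
  rw [hS]
  refine hcard.trans (Nat.add_le_add_right ?_ _)
  rw [hH₀e]
  exact (Set.ncard_union_le _ _).trans (Nat.add_le_add_left hEc _)

/-- Each level adds `38 γ q ^ i`, more than the `4 R i = 32 q ^ i` of a detour. The indices start at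
1 because level 0 is treated by path buying. -/
lemma schedule_pow {γ q : ℕ} (hγ : 1 ≤ γ) (hq : 16 ≤ q) (K : ℕ) :
    Schedule 1 K (fun _ ↦ q) (fun i ↦ q ^ i) (fun i ↦ 38 * γ * i * q ^ (i - 1))
      (fun i ↦ 8 * q ^ i) := by
  have key : ∀ i, 1 ≤ i → q * q ^ (i - 1) = q ^ i := fun i hi ↦ by
    rw [← pow_succ', Nat.sub_add_cancel hi]
  refine ⟨fun i _ _ ↦ pow_succ' _ _, fun i hi _ ↦ ?_, fun i hi _ ↦ ?_, fun i hi _ ↦ ?_⟩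
  · have := key i hi
    rw [Nat.add_sub_cancel, ← this]
    nlinarith [Nat.zero_le (γ * (q * q ^ (i - 1)))]
  · have h1 := key i hi
    have h2 : (q - 1) * (38 * γ * i * q ^ (i - 1)) ≤ q * (38 * γ * i * q ^ (i - 1)) :=
      Nat.mul_le_mul_right _ (Nat.sub_le _ _)
    rw [Nat.add_sub_cancel]
    have h3 : q * (38 * γ * i * q ^ (i - 1)) = 38 * γ * i * q ^ i := by rw [← h1]; ring
    have h4 : q ^ i ≤ γ * q ^ i := Nat.le_mul_of_pos_left _ hγ
    have h5 : 38 * γ * (i + 1) * q ^ i = 38 * γ * i * q ^ i + 38 * (γ * q ^ i) := by ring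
    rw [h5]
    omega
  · rw [pow_succ]
    nlinarith [Nat.zero_le (q ^ i)]

/-- The spanner of a hierarchy of levels `A 0, …, A K`. -/
theorem exists_spanner_of_levels [Finite V] (G : SimpleGraph V) {γ K q : ℕ} (hγ : 1 ≤ γ)
    (hK : 1 ≤ K) (hq : 16 ≤ q) (hγq : γ ≤ q) (A : ℕ → Finset V) (hAK : A (K + 1) = ∅) (f : ℕ → ℝ)
    (hf : ∀ d : ℕ, ((d + d / q ^ (K + 1) * (38 * γ * (K + 1) * q ^ K) +
      ((d % q ^ (K + 1) / q ^ K + 1) * (38 * γ * K * q ^ (K - 1)) + 32 * q ^ K) : ℕ) : ℝ) ≤ f d) :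
    ∃ S : Spanner G f, S.size ≤ (sparseEdges G (A 0) γ).ncard + (K + 1) * Nat.card V +
      30 * γ ^ 2 * (bunch G (A 0) (A 1)).ncard +
      ∑ i ∈ Finset.Icc 1 K, 2 * q ^ (i + 1) * (bunch G (A i) (A (i + 1))).ncard := by
  choose E hEG hEc hE using fun i ↦ exists_forest G (A i)
  choose F hFG hFc hF using fun i ↦
    exists_short_paths G (bunch G (A i) (A (i + 1))) (2 * q ^ (i + 1))
  set D₀ : Set (Sym2 V) := sparseEdges G (A 0) γ ∪ ⋃ i ∈ Finset.range (K + 1), E i with hD₀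
  set D₁ : Set (Sym2 V) := ⋃ i ∈ Finset.Icc 1 K, F i with hD₁
  have hD₀G : D₀ ⊆ G.edgeSet :=
    Set.union_subset (fun e he ↦ he.1) (Set.iUnion₂_subset fun i _ ↦ hEG i)
  have hD₁G : D₁ ⊆ G.edgeSet := Set.iUnion₂_subset fun i _ ↦ hFG i
  set H₀ := SimpleGraph.fromEdgeSet D₀ with hH₀
  have hH₀e : H₀.edgeSet = D₀ := edgeSet_fromEdgeSet_of_subset hD₀G
  have hH₀G : H₀ ≤ G := by
    rw [← SimpleGraph.edgeSet_subset_edgeSet, hH₀e]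
    exact hD₀G
  have hEH₀ : ∀ i ≤ K, SimpleGraph.fromEdgeSet (E i) ≤ H₀ := fun i hi ↦
    SimpleGraph.fromEdgeSet_mono (Set.subset_union_of_subset_right
      (Set.subset_biUnion_of_mem (u := fun i ↦ E i) (by simp; omega)) _)
  obtain ⟨H₁, hH₀₁, hH₁G, hcard₁, hH₁⟩ := exists_base_spanner G hγ (A 0) (A 1) q H₀ hH₀G
    (by rw [hH₀e]; exact Set.subset_union_left)
    (fun n x hx ↦ by
      obtain ⟨a, ha, hxa⟩ := hE 0 n x hx
      exact ⟨a, ha, hxa.of_le (hEH₀ 0 (Nat.zero_le K))⟩)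
  set H₂ := SimpleGraph.fromEdgeSet D₁ with hH₂
  have hH₂e : H₂.edgeSet = D₁ := edgeSet_fromEdgeSet_of_subset hD₁G
  have hH₂G : H₂ ≤ G := by
    rw [← SimpleGraph.edgeSet_subset_edgeSet, hH₂e]
    exact hD₁G
  set H := H₁ ⊔ H₂ with hH
  have hT := distRel_within H
  have hcard : H.edgeSet.ncard ≤ (sparseEdges G (A 0) γ).ncard + (K + 1) * Nat.card V +
      30 * γ ^ 2 * (bunch G (A 0) (A 1)).ncard +
      ∑ i ∈ Finset.Icc 1 K, 2 * q ^ (i + 1) * (bunch G (A i) (A (i + 1))).ncard := by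
    rw [hH, SimpleGraph.edgeSet_sup]
    refine (Set.ncard_union_le _ _).trans (add_le_add (hcard₁.trans (Nat.add_le_add_right ?_ _)) ?_)
    · rw [hH₀e]
      refine (Set.ncard_union_le _ _).trans (Nat.add_le_add_left ?_ _)
      refine (Finset.set_ncard_biUnion_le _ _).trans ?_
      refine (Finset.sum_le_card_nsmul _ _ _ fun i _ ↦ hEc i).trans ?_
      rw [Finset.card_range, smul_eq_mul]
    · rw [hH₂e]
      exact (Finset.set_ncard_biUnion_le _ _).trans (Finset.sum_le_sum fun i _ ↦ hFc i)
  have hA : ∀ i ≤ K, ∀ x n, Meets G (A i) n x → ∃ a ∈ A i, Within G n x a ∧ Within H n x a := by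
    intro i hi x n hx
    obtain ⟨a, ha, hxa⟩ := hE i n x hx
    have h1 := hxa.of_le (hEH₀ i hi)
    exact ⟨a, ha, h1.of_le hH₀G, h1.of_le (hH₀₁.trans le_sup_left)⟩
  have hAA : ∀ i, 1 ≤ i → i ≤ K → ∀ a ∈ A i, ∀ b ∈ A i, ∀ n ≤ q ^ (i + 1) + 2 * (8 * q ^ i),
      Within G n a b → Within H n a b ∨ Meets G (A (i + 1)) n a ∧ Meets G (A (i + 1)) n b := by
    intro i hi hiK a ha b hb n hn hab
    refine bunch_dichotomy hT (fun p hp n' hn' hpn ↦ ?_) ha hb hab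
    refine (hF i p hp n' ?_ hpn).of_le (le_trans ?_ le_sup_right)
    · have : 16 * q ^ i ≤ q ^ (i + 1) := by
        rw [pow_succ']
        exact Nat.mul_le_mul_right _ hq
      omega
    · exact SimpleGraph.fromEdgeSet_mono
        (Set.subset_biUnion_of_mem (u := fun i ↦ F i) (by simp; omega))
  have hbase : Dichotomy G (Within H) (A 1) (q ^ 1) (38 * γ * 1 * q ^ (1 - 1)) (8 * q ^ 1) := by
    have h1 : Dichotomy G (Within H) (A 1) q (6 * γ) (2 * q + 4 * γ) := by
      intro x y d hd hxy
      exact (hH₁ x y d hd hxy).imp_left fun h ↦ h.of_le le_sup_left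
    refine h1.mono hT (by simp) ?_ ?_
    · simp only [mul_one, Nat.sub_self, pow_zero]
      omega
    · rw [pow_one]
      omega
  have hlevel := (schedule_pow hγ hq K).dichotomy hT hA
    (fun i hi₁ hi ↦ hAA i hi₁ hi.le) hbase hK le_rfl
  have hAAK : ∀ a ∈ A K, ∀ b ∈ A K, ∀ n ≤ q ^ (K + 1) + 2 * (8 * q ^ K),
      Within G n a b → Within H n a b := by
    intro a ha b hb n hn hab
    refine (hAA K hK le_rfl a ha b hb n hn hab).resolve_right fun h ↦ ?_
    obtain ⟨a', ha', -⟩ := h.1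
    simp [hAK] at ha'
  have hqK : q * q ^ K = q ^ (K + 1) := (pow_succ' _ _).symm
  have hqK' : q * q ^ (K - 1) = q ^ K := by rw [← pow_succ', Nat.sub_add_cancel hK]
  have hfull : ∀ x y d, d ≤ q ^ (K + 1) → Within G d x y →
      Within H (d + 38 * γ * (K + 1) * q ^ K) x y := by
    intro x y d hd hxy
    have h1 : q * (38 * γ * K * q ^ (K - 1)) = 38 * γ * K * q ^ K := by rw [← hqK']; ring
    have h2 : (q - 1) * (38 * γ * K * q ^ (K - 1)) ≤ q * (38 * γ * K * q ^ (K - 1)) :=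
      Nat.mul_le_mul_right _ (Nat.sub_le _ _)
    have h4 : q ^ K ≤ γ * q ^ K := Nat.le_mul_of_pos_left _ hγ
    exact hlevel.of_top hT q _ (hA K le_rfl) (by rw [hqK]; exact hAAK) (by nlinarith)
      (by nlinarith) (by rwa [hqK]) hxy
  -- The last, shorter portion is cut into only as many pieces of length `q ^ K` as it needs, so
  -- that apart from an additive term its error is proportional to its length.
  have hpart : ∀ x y d, d < q ^ (K + 1) → Within G d x y →
      Within H (d + ((d / q ^ K + 1) * (38 * γ * K * q ^ (K - 1)) + 32 * q ^ K)) x y := by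
    intro x y d hd hxy
    have hpos : 0 < q ^ K := Nat.pow_pos (by omega)
    have h1 : d / q ^ K + 1 ≤ q := by
      rw [Nat.add_one_le_iff, Nat.div_lt_iff_lt_mul hpos, hqK]
      exact hd
    have h2 : (d / q ^ K + 1) * q ^ K ≤ q ^ (K + 1) := by
      rw [← hqK]
      exact Nat.mul_le_mul_right _ h1
    refine hlevel.of_top hT (d / q ^ K + 1) _ (hA K le_rfl)
      (fun a ha b hb n hn ↦ hAAK a ha b hb n (by omega)) (by omega) ?_ ?_ hxy
    · rw [Nat.add_sub_cancel, add_mul, one_mul]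
      omega
    · rw [mul_comm]
      exact (Nat.lt_mul_div_succ d hpos).le
  obtain ⟨S, hS⟩ := exists_spanner_of_within (sup_le hH₁G hH₂G) f (fun x y hxy ↦ by
    refine ⟨_, ?_, hf (G.dist x y)⟩
    obtain ⟨p, hp⟩ := hxy.exists_walk_length_eq_dist
    rw [← hp]
    set d := p.length
    set Λ := q ^ (K + 1)
    have hΛ : 0 < Λ := Nat.pow_pos (by omega)
    have hdm := Nat.div_add_mod d Λ
    have h1 := hT.chain (fun j ↦ p.getVert (j * Λ)) (fun j ↦ j * Λ)
      (fun i j hij ↦ Nat.mul_le_mul_right _ hij) (38 * γ * (K + 1) * q ^ K)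
      (Nat.zero_le (d / Λ)) (fun j _ _ ↦ by
        refine hfull _ _ _ ?_ (within_getVert p (Nat.mul_le_mul_right _ (Nat.le_succ j)))
        rw [add_mul, one_mul]
        omega)
    have h2 := hpart _ _ (d % Λ) (Nat.mod_lt _ hΛ)
      ((within_getVert p (i := d / Λ * Λ) (j := d) (by rw [mul_comm]; omega)).mono
        (by rw [mul_comm]; omega))
    rw [p.getVert_length] at h2
    simp only [zero_mul, p.getVert_zero, Nat.sub_zero] at h1
    refine (h1.trans h2).mono ?_
    rw [mul_comm (d / Λ) Λ]
    omega)
  exact ⟨S, hS ▸ hcard⟩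

end SpannerConstruction

/-! ### Choosing the lengths for a given distance -/

section Stretch

/-- The additive error `O(γ (k d + 3 ^ k))`. -/
lemma exists_schedule_small (γ K d : ℕ) (hγ : 1 ≤ γ) :
    ∃ q l e R, Schedule 0 K q l e R ∧ l 0 = 1 ∧ R 0 = γ ∧
      ∃ Q e' : ℕ, d ≤ Q * l K ∧ Q * e K ≤ e' ∧ (Q - 1) * e K + 4 * R K ≤ e' ∧
        e' ≤ 20 * γ * ((K + 1) * d + 2 * 3 ^ (K + 1)) := by
  set k := K + 1 with hk
  -- The lengths stay 1 until `3 ^ i` reaches the order of `k`. From then on `k * l i` is comparable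
  -- to `3 ^ i`, and the lengths add only `O(3 ^ i)` to the radii over all levels.
  set i₀ := Nat.log 3 k with hi₀
  have hlow : 3 ^ i₀ ≤ k := Nat.pow_log_le_self 3 (by omega)
  have hupp : k < 3 ^ (i₀ + 1) := Nat.lt_pow_succ_log_self (by norm_num) k
  set l : ℕ → ℕ := fun i ↦ 3 ^ (i - i₀) with hl
  have hl1 : ∀ i, 3 ^ i ≤ k * l i := by
    intro i
    calc 3 ^ i ≤ 3 ^ (i₀ + (i - i₀)) := Nat.pow_le_pow_right (by norm_num) (by omega)
      _ = 3 ^ i₀ * l i := pow_add _ _ _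
      _ ≤ k * l i := Nat.mul_le_mul_right _ hlow
  have hl2 : ∀ i, k * l i ≤ 3 ^ (i + 1) + k := by
    intro i
    rcases Nat.lt_or_ge i i₀ with h | h
    · simp only [hl, Nat.sub_eq_zero_of_le h.le, pow_zero, mul_one]
      exact Nat.le_add_left _ _
    · calc k * l i ≤ 3 ^ (i₀ + 1) * l i := Nat.mul_le_mul_right _ hupp.le
        _ = 3 ^ (i + 1) := by rw [hl, ← pow_add]; congr 1; omega
        _ ≤ _ := Nat.le_add_right _ _
  -- The exact solution of `r (i + 1) = 3 r i + 3 ^ (i + 2) / k + 1` with `r 0 = γ`, where the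
  -- inhomogeneous term bounds `l (i + 1)`.
  set r : ℕ → ℝ := fun i ↦ 3 ^ i * (γ + 1 / 2 + 3 * i / k) - 1 / 2 with hr
  have hk0 : (0 : ℝ) < k := by positivity
  have hr0 : ∀ i, 0 ≤ r i := by
    intro i
    have h1 : (1 : ℝ) ≤ 3 ^ i := one_le_pow₀ (by norm_num)
    have h2 : (0 : ℝ) ≤ γ + 3 * i / k := by positivity
    simp only [hr]
    nlinarith
  set R : ℕ → ℕ := fun i ↦ ⌊r i⌋₊ with hR
  have hRr : ∀ i, (R i : ℝ) ≤ r i := fun i ↦ Nat.floor_le (hr0 i)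
  have hγ1 : (1 : ℝ) ≤ γ := by exact_mod_cast hγ
  have hR5 : ∀ i ≤ K, 4 * R i ≤ 20 * γ * k * l i := by
    intro i hi
    have h1 : (3 * i / k : ℝ) ≤ 3 := by
      rw [div_le_iff₀ hk0]
      have : (i : ℝ) ≤ k := by exact_mod_cast (by omega : i ≤ k)
      linarith
    have h2 : (R i : ℝ) ≤ 5 * γ * 3 ^ i := by
      have h3 : (0 : ℝ) < 3 ^ i := by positivity
      calc (R i : ℝ) ≤ r i := hRr i
        _ ≤ 3 ^ i * (γ + 1 / 2 + 3 * i / k) := by simp only [hr]; linarith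
        _ ≤ 3 ^ i * (5 * γ) := by
          gcongr
          linarith
        _ = _ := by ring
    have h3 : R i ≤ 5 * γ * 3 ^ i := by exact_mod_cast h2
    calc 4 * R i ≤ 4 * (5 * γ * 3 ^ i) := Nat.mul_le_mul_left _ h3
      _ ≤ 4 * (5 * γ * (k * l i)) := by gcongr; exact hl1 i
      _ = _ := by ring
  have hinc : ∀ i ≤ K, ∀ Q, 1 ≤ Q →
      (Q - 1) * (20 * γ * k * l i) + 4 * R i ≤ Q * (20 * γ * k * l i) := by
    intro i hi Q hQ
    obtain ⟨Q, rfl⟩ := Nat.exists_eq_add_of_le' hQ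
    rw [Nat.add_sub_cancel, add_mul Q, one_mul]
    exact Nat.add_le_add_left (hR5 i hi) _
  set q : ℕ → ℕ := fun i ↦ if i < i₀ then 1 else 3 with hq
  have hlS : ∀ i, l (i + 1) = q i * l i := by
    intro i
    simp only [hl, hq]
    split_ifs with h
    · rw [Nat.sub_eq_zero_of_le h.le, Nat.sub_eq_zero_of_le h]
      rfl
    · rw [← pow_succ']
      congr 1
      omega
  have heS : ∀ i, 20 * γ * k * l (i + 1) = q i * (20 * γ * k * l i) := by
    intro i
    rw [hlS]
    ring
  -- Errors proportional to lengths pass unchanged through good pieces, and one skipped piece pays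
  -- for the detour since `4 R i ≤ 20 γ k l i`.
  refine ⟨q, l, fun i ↦ 20 * γ * k * l i, R, ⟨fun i _ _ ↦ hlS i, fun i _ _ ↦ (heS i).ge,
    fun i _ hi ↦ ?_, fun i _ hi ↦ ?_⟩, ?_, ?_, d / l K + 1, (d / l K + 1) * (20 * γ * k * l K),
    ?_, le_rfl, hinc K le_rfl _ (Nat.le_add_left 1 _), ?_⟩
  · rw [heS]
    refine hinc i hi.le _ ?_
    simp only [hq]
    split_ifs <;> omega
  · refine Nat.le_floor ?_
    have h1 : (l (i + 1) : ℝ) ≤ 3 ^ (i + 2) / k + 1 := by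
      rw [div_add_one hk0.ne', le_div_iff₀ hk0, mul_comm]
      exact_mod_cast hl2 (i + 1)
    have h2 : r (i + 1) = 3 ^ (i + 2) / k + 1 + 3 * r i := by
      simp only [hr]
      push_cast
      field_simp
      ring
    rw [h2]
    push_cast
    linarith [hRr i]
  · simp [hl]
  · have : r 0 = γ := by simp [hr]
    simp only [hR, this, Nat.floor_natCast]
  · rw [mul_comm]
    exact (Nat.lt_mul_div_succ d (by positivity)).le
  · calc (d / l K + 1) * (20 * γ * k * l K)
        = 20 * γ * (k * (d / l K * l K) + k * l K) := by ring
      _ ≤ 20 * γ * (k * d + (3 ^ (K + 1) + k)) := by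
          gcongr
          · exact Nat.div_mul_le_self d _
          · exact hl2 K
      _ ≤ 20 * γ * (k * d + 2 * 3 ^ (K + 1)) := by
          have : k ≤ 3 ^ (K + 1) := (Nat.lt_pow_self (by norm_num)).le
          gcongr
          omega

/-- Multiples of each other that approximate the powers of `x`. -/
noncomputable def powApprox (x : ℝ) : ℕ → ℕ
  | 0 => 1
  | i + 1 => ⌈x ^ (i + 1) / (powApprox x i : ℝ)⌉₊ * powApprox x i

/-- The additive error `O(γ k d ^ (1 - 1 / k))`, where `d = x ^ k`. -/
lemma exists_schedule_large (γ K d : ℕ) (hγ : 1 ≤ γ) (x : ℝ) (hx : 4 ≤ x)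
    (hxd : x ^ (K + 1) = d) :
    ∃ q l e R, Schedule 0 K q l e R ∧ l 0 = 1 ∧ R 0 = γ ∧
      ∃ Q e' : ℕ, d ≤ Q * l K ∧ Q * e K ≤ e' ∧ (Q - 1) * e K + 4 * R K ≤ e' ∧
        (e' : ℝ) ≤ 48 * γ * ((K + 1) * x ^ K) := by
  have hx0 : 0 < x := by linarith
  have hγ1 : (1 : ℝ) ≤ γ := by exact_mod_cast hγ
  set l : ℕ → ℕ := powApprox x with hl
  set q : ℕ → ℕ := fun i ↦ ⌈x ^ (i + 1) / (l i : ℝ)⌉₊ with hq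
  have hlS : ∀ i, l (i + 1) = q i * l i := fun i ↦ rfl
  have hl0 : l 0 = 1 := rfl
  have hlpos : ∀ i, (0 : ℝ) < l i := by
    intro i
    induction i with
    | zero => simp [hl0]
    | succ i ih =>
      rw [hlS, Nat.cast_mul]
      have : 0 < q i := Nat.ceil_pos.2 (by positivity)
      positivity
  have hllow : ∀ i, x ^ i ≤ l i := by
    intro i
    cases i with
    | zero => simp [hl0]
    | succ i =>
      rw [hlS, Nat.cast_mul, ← div_le_iff₀ (hlpos i)]
      exact Nat.le_ceil _
  -- Rounding adds at most `l i` to `x ^ (i + 1)`, a geometric loss because `x ≥ 4`.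
  have hlupp : ∀ i, (l i : ℝ) ≤ 4 / 3 * x ^ i := by
    intro i
    induction i with
    | zero => norm_num [hl0]
    | succ i ih =>
      have h1 : (q i : ℝ) ≤ x ^ (i + 1) / l i + 1 :=
        (Nat.ceil_lt_add_one (div_nonneg (by positivity) (hlpos i).le)).le
      have h2 := hlpos i
      rw [hlS, Nat.cast_mul]
      calc (q i : ℝ) * l i ≤ (x ^ (i + 1) / l i + 1) * l i := by gcongr
        _ = x ^ (i + 1) + l i := by field_simp
        _ ≤ x ^ (i + 1) + 4 / 3 * x ^ i := by gcongr
        _ ≤ 4 / 3 * x ^ (i + 1) := by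
          have : 0 < x ^ i := by positivity
          rw [pow_succ]
          nlinarith
  set r : ℕ → ℝ := fun i ↦ 6 * γ * x ^ i with hr
  set R : ℕ → ℕ := fun i ↦ if i = 0 then γ else ⌊r i⌋₊ with hR
  have hRr : ∀ i, (R i : ℝ) ≤ r i := by
    intro i
    simp only [hR]
    split_ifs with h
    · subst h
      simp only [hr, pow_zero]
      linarith
    · exact Nat.floor_le (by positivity)
  -- The detour `4 R i ≤ 24 γ x ^ i` is at most `24 γ l (i + 1) / x`, so each level raises the error
  -- per unit length by `24 γ / x`.
  set e : ℕ → ℕ := fun i ↦ ⌊24 * i * γ * l i / x⌋₊ with he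
  have her : ∀ i, (e i : ℝ) ≤ 24 * i * γ * l i / x := fun i ↦ Nat.floor_le (by positivity)
  refine ⟨q, l, e, R, ⟨fun i _ _ ↦ hlS i, fun i _ hi ↦ ?_, fun i _ hi ↦ ?_, fun i _ hi ↦ ?_⟩,
    hl0, by simp [hR], ⌈d / (l K : ℝ)⌉₊, ⌈d / (l K : ℝ)⌉₊ * e K + 4 * R K, ?_, by omega, ?_, ?_⟩
  · refine Nat.le_floor ?_
    rw [hlS]
    push_cast
    calc (q i : ℝ) * e i ≤ q i * (24 * i * γ * l i / x) := by gcongr; exact her i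
      _ = 24 * i * γ * (q i * l i) / x := by ring
      _ ≤ 24 * (i + 1) * γ * (q i * l i) / x := by gcongr; linarith
  · refine Nat.le_floor ?_
    have h1 : ((q i - 1 : ℕ) : ℝ) ≤ q i := by exact_mod_cast Nat.sub_le _ _
    have h2 : x ^ i ≤ l (i + 1) / x := by
      rw [le_div_iff₀ hx0, ← pow_succ]
      exact hllow _
    have h3 : (l (i + 1) : ℝ) = q i * l i := by rw [hlS, Nat.cast_mul]
    push_cast
    calc ((q i - 1 : ℕ) : ℝ) * e i + 4 * R i ≤ q i * (24 * i * γ * l i / x) + 4 * r i := by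
          gcongr
          · exact her i
          · exact hRr i
      _ = 24 * i * γ * (l (i + 1) / x) + 24 * γ * x ^ i := by rw [h3]; simp only [hr]; ring
      _ ≤ 24 * i * γ * (l (i + 1) / x) + 24 * γ * (l (i + 1) / x) := by gcongr
      _ = 24 * (i + 1) * γ * l (i + 1) / x := by ring
  · simp only [hR, if_neg (Nat.succ_ne_zero i)]
    refine Nat.le_floor ?_
    have h1 := hlupp (i + 1)
    have h2 : (R i : ℝ) ≤ 6 * γ * x ^ i := hRr i
    have h3 : 0 < x ^ i := by positivity
    simp only [hR] at h2
    push_cast at h2 ⊢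
    simp only [hr]
    calc (l (i + 1) : ℝ) + 3 * _ ≤ 4 / 3 * x ^ (i + 1) + 3 * (6 * γ * x ^ i) := by gcongr
      _ ≤ 6 * γ * x ^ (i + 1) := by
        rw [pow_succ]
        have h4 : 4 * x ^ i ≤ x ^ i * x := by nlinarith
        have h5 : x ^ i * x ≤ γ * (x ^ i * x) := by nlinarith
        nlinarith
  · have : (d : ℝ) ≤ ⌈d / (l K : ℝ)⌉₊ * l K := by
      rw [← div_le_iff₀ (hlpos K)]
      exact Nat.le_ceil _
    exact_mod_cast this
  · exact Nat.add_le_add_right (Nat.mul_le_mul_right _ (Nat.sub_le _ _)) _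
  · have hd0 : (0 : ℝ) ≤ d := by positivity
    have h1 : (⌈d / (l K : ℝ)⌉₊ : ℝ) * l K ≤ 2 * d := by
      have h2 : (⌈d / (l K : ℝ)⌉₊ : ℝ) ≤ d / l K + 1 :=
        (Nat.ceil_lt_add_one (div_nonneg hd0 (hlpos K).le)).le
      have h3 := hlpos K
      have h4 : (l K : ℝ) ≤ d := by
        refine (hlupp K).trans ?_
        rw [← hxd, pow_succ]
        have : 0 < x ^ K := by positivity
        nlinarith
      calc (⌈d / (l K : ℝ)⌉₊ : ℝ) * l K ≤ (d / l K + 1) * l K := by gcongr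
        _ = d + l K := by field_simp
        _ ≤ 2 * d := by linarith
    have h2 : (d : ℝ) / x = x ^ K := by rw [← hxd, pow_succ]; field_simp
    push_cast
    calc (⌈d / (l K : ℝ)⌉₊ : ℝ) * e K + 4 * R K
        ≤ ⌈d / (l K : ℝ)⌉₊ * (24 * K * γ * l K / x) + 4 * r K := by
          gcongr
          · exact her K
          · exact hRr K
      _ = 24 * K * γ * (⌈d / (l K : ℝ)⌉₊ * l K) / x + 24 * γ * x ^ K := by simp only [hr]; ring
      _ ≤ 24 * K * γ * (2 * d) / x + 24 * γ * x ^ K := by gcongr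
      _ = 48 * γ * (K * (d / x)) + 24 * γ * x ^ K := by ring
      _ ≤ 48 * γ * ((K + 1) * x ^ K) := by
        rw [h2]
        have : 0 ≤ γ * x ^ K := by positivity
        nlinarith

lemma exists_schedule (γ k d : ℕ) (hγ : 1 ≤ γ) (hk : 1 ≤ k) (C : ℝ) (hC : 80 ≤ C) :
    ∃ q l e R, Schedule 0 (k - 1) q l e R ∧ l 0 = 1 ∧ R 0 = γ ∧
      ∃ Q e' : ℕ, d ≤ Q * l (k - 1) ∧ Q * e (k - 1) ≤ e' ∧
        (Q - 1) * e (k - 1) + 4 * R (k - 1) ≤ e' ∧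
        ((d + e' : ℕ) : ℝ) ≤
          d + C * γ * (k * (d : ℝ) ^ (1 - 1 / (k : ℝ)) + 3 ^ k) := by
  obtain ⟨K, rfl⟩ := Nat.exists_eq_add_of_le' hk
  rw [Nat.add_sub_cancel]
  have hγ0 : (0 : ℝ) ≤ γ := by positivity
  set t : ℝ := (d : ℝ) ^ (1 - 1 / ((K + 1 : ℕ) : ℝ)) with ht
  have ht0 : 0 ≤ t := by positivity
  set x : ℝ := (d : ℝ) ^ (1 / ((K + 1 : ℕ) : ℝ)) with hx
  have hxd : x ^ (K + 1) = d := by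
    rw [hx, one_div]
    exact Real.rpow_inv_natCast_pow (by positivity) (by omega)
  -- If `d ^ (1 / k) < 4`, then `d ≤ 4 d ^ (1 - 1 / k)` and an error linear in `d` is affordable;
  -- this is the source of `80 = 20 * 4`.
  rcases le_or_gt 4 x with h | h
  · obtain ⟨q, l, e, R, hS, hl, hR, Q, e', h1, h2, h3, h4⟩ :=
      exists_schedule_large γ K d hγ x h hxd
    refine ⟨q, l, e, R, hS, hl, hR, Q, e', h1, h2, h3, ?_⟩
    have hxK : x ^ K = t := by
      have hx0 : x ≠ 0 := by linarith
      have hd0 : (0 : ℝ) < d := by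
        rw [← hxd]
        positivity
      rw [ht, Real.rpow_sub hd0, Real.rpow_one, ← hx, ← hxd, pow_succ]
      field_simp
    rw [hxK] at h4
    push_cast
    have h5 : 48 * γ * (((K : ℝ) + 1) * t) ≤ C * γ * ((K + 1) * t + 3 ^ (K + 1)) := by
      gcongr
      · linarith
      · exact le_add_of_nonneg_right (by positivity)
    linarith
  · obtain ⟨q, l, e, R, hS, hl, hR, Q, e', h1, h2, h3, h4⟩ := exists_schedule_small γ K d hγ
    refine ⟨q, l, e, R, hS, hl, hR, Q, e', h1, h2, h3, ?_⟩
    have hdt : (d : ℝ) ≤ 4 * t := by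
      rcases Nat.eq_zero_or_pos d with rfl | hd
      · simpa using ht0
      · have hd0 : (0 : ℝ) < d := by exact_mod_cast hd
        calc (d : ℝ) = x * t := by
              rw [hx, ht, ← Real.rpow_add hd0]
              simp
          _ ≤ 4 * t := by gcongr
    have h5 : (e' : ℝ) ≤ 20 * γ * ((K + 1) * d + 2 * 3 ^ (K + 1)) := by exact_mod_cast h4
    push_cast
    have h6 : 20 * γ * (((K : ℝ) + 1) * d + 2 * 3 ^ (K + 1)) ≤
        C * γ * ((K + 1) * t + 3 ^ (K + 1)) := by
      have h7 : (0 : ℝ) ≤ 3 ^ (K + 1) := by positivity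
      calc 20 * γ * (((K : ℝ) + 1) * d + 2 * 3 ^ (K + 1))
          ≤ 20 * γ * (((K : ℝ) + 1) * (4 * t) + 4 * 3 ^ (K + 1)) := by
            gcongr
            norm_num
        _ = 80 * γ * (((K : ℝ) + 1) * t + 3 ^ (K + 1)) := by ring
        _ ≤ _ := by gcongr
    linarith

end Stretch

/-! ### Counting edges -/

section Size

variable {V : Type u} [Fintype V] {G : SimpleGraph V} {γ : ℕ}

lemma one_le_girthExp (γ k : ℕ) (hγ : 1 ≤ γ) : 1 ≤ (γ + 1) * 2 ^ k - 1 := by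
  have h1 : 1 ≤ 2 ^ k := Nat.one_le_two_pow
  have h2 : 2 * 1 ≤ (γ + 1) * 2 ^ k := Nat.mul_le_mul (by omega) h1
  omega

lemma cast_girthExp (γ k : ℕ) :
    (((γ + 1) * 2 ^ k - 1 : ℕ) : ℝ) = ((γ : ℝ) + 1) * 2 ^ k - 1 := by
  have h1 : 1 ≤ (γ + 1) * 2 ^ k := Nat.mul_pos (by omega) (by positivity)
  push_cast [Nat.cast_sub h1]
  ring

/-- The sparsity of the levels when the paths have lengths `q ^ c i`. -/
theorem exists_hierarchy_rpow (hγ : 1 ≤ γ) (hG : ((2 * γ + 1 : ℕ) : ℕ∞) ≤ G.egirth) (k : ℕ)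
    (hk : 1 ≤ k) (hV : 1 ≤ Fintype.card V) (q : ℝ) (hq : 1 ≤ q) (c : ℕ → ℕ) :
    ∃ A : ℕ → Finset V, ∃ X : ℝ, (Fintype.card V : ℝ) ≤ X ∧
      X = q ^ ((lengthExp c k : ℝ) / (((γ : ℝ) + 1) * 2 ^ k - 1)) *
        (Fintype.card V : ℝ) ^ (1 + 1 / (((γ : ℝ) + 1) * (2 : ℝ) ^ k - 1)) ∧ A k = ∅ ∧
      ((sparseEdges G (A 0) γ).ncard : ℝ) ≤ 32 * X ∧
      ∀ i < k, (γ : ℝ) ^ 2 * q ^ c i * (bunch G (A i) (A (i + 1))).ncard ≤ 8 * X := by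
  set M := (γ + 1) * 2 ^ k - 1 with hM
  have hM1 : 1 ≤ M := one_le_girthExp γ k hγ
  have hMr : (M : ℝ) = ((γ : ℝ) + 1) * 2 ^ k - 1 := cast_girthExp γ k
  have hn1 : (1 : ℝ) ≤ Fintype.card V := by exact_mod_cast hV
  have hq0 : 0 < q := by linarith
  have hn0 : (0 : ℝ) < Fintype.card V := by linarith
  set y : ℝ := Fintype.card V * q ^ lengthExp c k with hy
  have hy1 : 1 ≤ y := one_le_mul_of_one_le_of_one_le hn1 (one_le_pow₀ hq)
  set x : ℝ := y ^ ((M : ℝ)⁻¹) with hx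
  have hx1 : 1 ≤ x := Real.one_le_rpow hy1 (by positivity)
  have hxM : x ^ M = y := Real.rpow_inv_natCast_pow (by linarith) (by omega)
  obtain ⟨A, hA, hA0, hAi⟩ := exists_hierarchy hγ hG k hk hV q hq c x hx1 hxM
  refine ⟨A, Fintype.card V * x, le_mul_of_one_le_right hn0.le hx1, ?_, hA, hA0, hAi⟩
  rw [hx, hy, ← hMr, Real.mul_rpow hn0.le (by positivity), ← Real.rpow_natCast q,
    ← Real.rpow_mul hq0.le, Real.rpow_add hn0, Real.rpow_one]
  simp only [div_eq_mul_inv, one_mul]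
  ring

theorem exists_emulator (hγ : 1 ≤ γ) (hG : ((2 * γ + 1 : ℕ) : ℕ∞) ≤ G.egirth) (k : ℕ)
    (hk : 1 ≤ k) (hV : 1 ≤ Fintype.card V) (f : ℕ → ℝ)
    (hf : ∀ d : ℕ, ∃ q l e R, Schedule 0 (k - 1) q l e R ∧ l 0 = 1 ∧ R 0 = γ ∧
      ∃ Q e' : ℕ, d ≤ Q * l (k - 1) ∧ Q * e (k - 1) ≤ e' ∧
        (Q - 1) * e (k - 1) + 4 * R (k - 1) ≤ e' ∧ ((d + e' : ℕ) : ℝ) ≤ f d) :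
    ∃ 𝓔 : Emulator G f, (𝓔.size : ℝ) ≤
      41 * k * (Fintype.card V : ℝ) ^ (1 + 1 / (((γ : ℝ) + 1) * (2 : ℝ) ^ k - 1)) := by
  obtain ⟨A, X, hnX, hX, hA, hA0, hAi⟩ :=
    -- With `q = 1` path lengths play no role: each bunch pair costs a single edge.
    exists_hierarchy_rpow hγ hG k hk hV 1 le_rfl (fun _ ↦ 0)
  rw [Real.one_rpow, one_mul] at hX
  rw [← hX]
  obtain ⟨K, rfl⟩ := Nat.exists_eq_add_of_le' hk
  have hγ1 : (1 : ℝ) ≤ γ := by exact_mod_cast hγ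
  obtain ⟨𝓔, h𝓔⟩ := exists_emulator_of_levels G γ K A hA f hf
  refine ⟨𝓔, ?_⟩
  have h1 : ∑ i ∈ Finset.range (K + 1), ((bunch G (A i) (A (i + 1))).ncard : ℝ) ≤
      (K + 1) * (8 * X) := by
    refine (Finset.sum_le_card_nsmul _ _ (8 * X) fun i hi ↦ ?_).trans ?_
    · refine le_trans ?_ (hAi i (Finset.mem_range.1 hi))
      rw [pow_zero, mul_one]
      exact le_mul_of_one_le_left (by positivity) (one_le_pow₀ hγ1)
    · rw [Finset.card_range, nsmul_eq_mul]
      push_cast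
      rfl
  have h2 : (𝓔.size : ℝ) ≤ (sparseEdges G (A 0) γ).ncard + (K + 1) * Fintype.card V +
      ∑ i ∈ Finset.range (K + 1), ((bunch G (A i) (A (i + 1))).ncard : ℝ) := by
    rw [← Nat.card_eq_fintype_card]
    exact_mod_cast h𝓔
  have hX0 : 0 ≤ X := le_trans (by positivity) hnX
  have h3 : ((K : ℝ) + 1) * Fintype.card V ≤ (K + 1) * X := by gcongr
  have h4 : 0 ≤ K * X := by positivity
  push_cast
  nlinarith

theorem exists_six_spanner (hγ : 1 ≤ γ) (hG : ((2 * γ + 1 : ℕ) : ℕ∞) ≤ G.egirth)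
    (hV : 1 ≤ Fintype.card V) :
    ∃ S : Spanner G (fun d => (d : ℝ) + 6 * (γ : ℝ)), (S.size : ℝ) ≤
      273 * (Fintype.card V : ℝ) ^ (1 + 1 / (2 * (γ : ℝ) + 1)) := by
  obtain ⟨A, X, hnX, hX, hA, hA0, hAi⟩ :=
    exists_hierarchy_rpow hγ hG 1 le_rfl hV 1 le_rfl (fun _ ↦ 0)
  rw [Real.one_rpow, one_mul] at hX
  have hexp : ((γ : ℝ) + 1) * 2 ^ 1 - 1 = 2 * γ + 1 := by ring
  rw [hexp] at hX
  rw [← hX]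
  obtain ⟨S, hS⟩ := exists_additive_spanner G hγ (A 0)
  refine ⟨S, ?_⟩
  have h1 := hAi 0 one_pos
  rw [hA] at h1
  have h2 : (S.size : ℝ) ≤ (sparseEdges G (A 0) γ).ncard + Fintype.card V +
      30 * γ ^ 2 * (bunch G (A 0) ∅).ncard := by
    rw [← Nat.card_eq_fintype_card]
    exact_mod_cast hS
  rw [pow_zero, mul_one] at h1
  linarith

/-- The exponents of the path lengths of the spanners. -/
def spannerExp (i : ℕ) : ℕ := if i = 0 then 0 else i + 1

lemma cast_lengthExp_spannerExp (k : ℕ) :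
    (lengthExp spannerExp (k + 1) : ℝ) = 3 * 2 ^ k - ((k + 1 : ℕ) + 2) := by
  induction k with
  | zero =>
    norm_num [lengthExp, spannerExp]
  | succ k ih =>
    rw [lengthExp, Nat.cast_add, Nat.cast_mul, ih, spannerExp, if_neg (Nat.succ_ne_zero k)]
    push_cast
    ring

lemma hExp_lt (γ k : ℕ) (hγ : 1 ≤ γ) (hk : 1 ≤ k) : hExp γ k < 3 / (2 * ((γ : ℝ) + 1)) := by
  obtain ⟨k, rfl⟩ := Nat.exists_eq_add_of_le' hk
  have h1 : (1 : ℝ) ≤ ((γ : ℝ) + 1) * 2 ^ (k + 1) - 1 := by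
    rw [← cast_girthExp]
    exact_mod_cast one_le_girthExp γ (k + 1) hγ
  have hγ1 : (1 : ℝ) ≤ γ := by exact_mod_cast hγ
  rw [hExp, div_lt_div_iff₀ (by linarith) (by linarith), Nat.add_sub_cancel, pow_succ]
  push_cast
  have h2 : (0 : ℝ) ≤ (k : ℝ) * (γ + 1) := by positivity
  nlinarith

theorem exists_sublinear_spanner (hγ : 1 ≤ γ) (hG : ((2 * γ + 1 : ℕ) : ℕ∞) ≤ G.egirth) (k : ℕ)
    (hk : 2 ≤ k) (hV : 1 ≤ Fintype.card V) (ε : ℝ) (hε : 0 < ε) (hε1 : ε ≤ 1) (C : ℝ)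
    (hC : 1287 ≤ C) :
    ∃ S : Spanner G (fun d => (1 + ε) * (d : ℝ) + (C * ((γ : ℝ) * (k : ℝ) / ε)) ^ (k - 1)),
      (S.size : ℝ) ≤ 39 * 289 * ((γ : ℝ) * (k : ℝ) / ε) ^ hExp γ k * (k : ℝ) *
        (Fintype.card V : ℝ) ^ (1 + 1 / (((γ : ℝ) + 1) * (2 : ℝ) ^ k - 1)) := by
  obtain ⟨K, rfl⟩ := Nat.exists_eq_add_of_le' (show 1 ≤ k by omega)
  have hK : 1 ≤ K := by omega
  have hγ1 : (1 : ℝ) ≤ γ := by exact_mod_cast hγ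
  have hKr : (1 : ℝ) ≤ K := by exact_mod_cast hK
  set Y : ℝ := (γ : ℝ) * ((K + 1 : ℕ) : ℝ) / ε with hY
  have hYε : ε * Y = γ * (K + 1) := by rw [hY]; push_cast; field_simp
  have hYγ : γ * (K + 1) ≤ Y := by
    rw [← hYε]
    exact mul_le_of_le_one_left (by positivity) hε1
  have hY1 : 1 ≤ Y := by nlinarith
  -- This makes the error `38 γ k q ^ K` of a full piece of length `q ^ (K + 1)` at most `ε` times
  -- its length. As `h ≤ 1`, replacing `q ^ h` by `Y ^ h` costs at most a factor 39.
  set q : ℕ := ⌈38 * Y⌉₊ with hq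
  have hq38 : 38 * Y ≤ q := Nat.le_ceil _
  have hq39 : (q : ℝ) ≤ 39 * Y := by
    have := (Nat.ceil_lt_add_one (by positivity : 0 ≤ 38 * Y)).le
    linarith
  have hq16 : 16 ≤ q := by
    have : (16 : ℝ) ≤ q := by linarith
    exact_mod_cast this
  have hγq : γ ≤ q := by
    have : (γ : ℝ) ≤ q := by nlinarith
    exact_mod_cast this
  have hq0 : (0 : ℝ) < q := by linarith
  have hqε : 38 * (γ * ((K : ℝ) + 1)) ≤ ε * q := by
    rw [← hYε]
    nlinarith
  obtain ⟨A, X, hnX, hX, hA, hA0, hAi⟩ := exists_hierarchy_rpow hγ hG (K + 1) (by omega) hV q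
    (by linarith) spannerExp
  have hX0 : 0 ≤ X := le_trans (by positivity) hnX
  have hh : (lengthExp spannerExp (K + 1) : ℝ) / (((γ : ℝ) + 1) * 2 ^ (K + 1) - 1) =
      hExp γ (K + 1) := by
    rw [cast_lengthExp_spannerExp, hExp, Nat.add_sub_cancel]
  have hh0 : 0 ≤ hExp γ (K + 1) := by
    rw [← hh, ← cast_girthExp]
    positivity
  have hh1 : hExp γ (K + 1) ≤ 1 := by
    refine (hExp_lt γ (K + 1) hγ (by omega)).le.trans ?_
    rw [div_le_one (by linarith)]
    linarith
  have hXle : X ≤ 39 * (Y ^ hExp γ (K + 1) * (Fintype.card V : ℝ) ^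
      (1 + 1 / (((γ : ℝ) + 1) * (2 : ℝ) ^ (K + 1) - 1))) := by
    rw [hX, hh, ← mul_assoc]
    gcongr
    calc (q : ℝ) ^ hExp γ (K + 1) ≤ (39 * Y) ^ hExp γ (K + 1) :=
          Real.rpow_le_rpow hq0.le hq39 hh0
      _ = 39 ^ hExp γ (K + 1) * Y ^ hExp γ (K + 1) :=
          Real.mul_rpow (by norm_num) (by positivity)
      _ ≤ 39 ^ (1 : ℝ) * Y ^ hExp γ (K + 1) := by
          gcongr
          norm_num
      _ = _ := by rw [Real.rpow_one]
  obtain ⟨S, hS⟩ := exists_spanner_of_levels G hγ hK hq16 hγq A hA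
    (fun d => (1 + ε) * (d : ℝ) + (C * Y) ^ (K + 1 - 1)) (fun d ↦ by
      rw [Nat.add_sub_cancel]
      have hqK : (0 : ℝ) < (q : ℝ) ^ K := by positivity
      have hKs : (q : ℝ) ^ (K - 1) * q = q ^ K := by rw [← pow_succ, Nat.sub_add_cancel hK]
      have h1 : 38 * (γ : ℝ) * (K + 1) * q ^ K ≤ ε * q ^ (K + 1) := by
        rw [pow_succ]
        nlinarith
      have h2 : 38 * (γ : ℝ) * K * q ^ (K - 1) ≤ ε * q ^ K := by
        have : (0 : ℝ) < (q : ℝ) ^ (K - 1) := by positivity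
        have h3 : 38 * (γ : ℝ) * K ≤ ε * q := by nlinarith
        rw [← hKs]
        nlinarith
      have h3 : 33 * (q : ℝ) ^ K ≤ (C * Y) ^ K := by
        calc 33 * (q : ℝ) ^ K ≤ 33 ^ K * q ^ K := by
              gcongr
              exact le_self_pow₀ (by norm_num) (by omega)
          _ = (33 * q) ^ K := (mul_pow _ _ _).symm
          _ ≤ (C * Y) ^ K := by
              refine pow_le_pow_left₀ (by positivity) ?_ K
              nlinarith
      set t := d / q ^ (K + 1) with ht
      set r := d % q ^ (K + 1) with hr
      have hd : (d : ℝ) = q ^ (K + 1) * t + r := by exact_mod_cast (Nat.div_add_mod d _).symm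
      set s := r / q ^ K with hs
      have hsr : (s : ℝ) * q ^ K ≤ r := by exact_mod_cast Nat.div_mul_le_self r (q ^ K)
      push_cast
      calc (d : ℝ) + t * (38 * γ * (K + 1) * q ^ K) +
            ((s + 1) * (38 * γ * K * q ^ (K - 1)) + 32 * q ^ K)
          ≤ d + t * (ε * q ^ (K + 1)) + ((s + 1) * (ε * q ^ K) + 32 * q ^ K) := by gcongr
        _ = d + ε * (q ^ (K + 1) * t) + ε * (s * q ^ K) + (ε + 32) * q ^ K := by ring
        _ ≤ d + ε * (q ^ (K + 1) * t) + ε * r + (1 + 32) * q ^ K := by gcongr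
        _ = (1 + ε) * (q ^ (K + 1) * t + r) + 33 * q ^ K := by rw [hd]; ring
        _ ≤ (1 + ε) * d + (C * Y) ^ K := by rw [← hd]; gcongr)
  refine ⟨S, ?_⟩
  have hsum : ∑ i ∈ Finset.Icc 1 K,
      (2 * (q : ℝ) ^ (i + 1) * (bunch G (A i) (A (i + 1))).ncard) ≤ K * (16 * X) := by
    refine (Finset.sum_le_card_nsmul _ _ (16 * X) fun i hi ↦ ?_).trans ?_
    · rw [Finset.mem_Icc] at hi
      have h1 := hAi i (by omega)
      rw [spannerExp, if_neg (by omega)] at h1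
      have h2 : (q : ℝ) ^ (i + 1) * (bunch G (A i) (A (i + 1))).ncard ≤
          (γ : ℝ) ^ 2 * ((q : ℝ) ^ (i + 1) * (bunch G (A i) (A (i + 1))).ncard) :=
        le_mul_of_one_le_left (by positivity) (one_le_pow₀ hγ1)
      linarith
    · rw [Nat.card_Icc, nsmul_eq_mul, Nat.add_sub_cancel]
  have hbase := hAi 0 (by omega)
  -- Level 0 carries no power of `q`, since path buying costs `30 γ ^ 2` edges per pair at any
  -- distance.
  rw [spannerExp, if_pos rfl, pow_zero, mul_one] at hbase
  have h2 : (S.size : ℝ) ≤ (sparseEdges G (A 0) γ).ncard + (K + 1) * Fintype.card V +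
      30 * γ ^ 2 * (bunch G (A 0) (A 1)).ncard +
      ∑ i ∈ Finset.Icc 1 K, (2 * (q : ℝ) ^ (i + 1) * (bunch G (A i) (A (i + 1))).ncard) := by
    rw [← Nat.card_eq_fintype_card]
    exact_mod_cast hS
  have h3 : ((K : ℝ) + 1) * Fintype.card V ≤ (K + 1) * X := by gcongr
  have h4 : 0 ≤ K * X := by positivity
  have h5 : (S.size : ℝ) ≤ 289 * ((K : ℝ) + 1) * X := by
    simp only [zero_add] at hbase
    nlinarith
  refine h5.trans ?_
  have h6 : 289 * ((K : ℝ) + 1) * X ≤ 289 * ((K : ℝ) + 1) * _ :=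
    mul_le_mul_of_nonneg_left hXle (by positivity)
  refine h6.trans (le_of_eq ?_)
  push_cast
  ring

lemma exists_emulator_of_isEmpty [IsEmpty V] (G : SimpleGraph V) (f : ℕ → ℝ) :
    ∃ 𝓔 : Emulator G f, 𝓔.size = 0 := by
  obtain ⟨𝓔, h⟩ := exists_emulator_of_edges G ∅ (fun _ _ h ↦ h.elim) f
    (fun _ _ _ x ↦ isEmptyElim x)
  exact ⟨𝓔, by simpa using h⟩

lemma exists_spanner_of_isEmpty [IsEmpty V] (G : SimpleGraph V) (f : ℕ → ℝ) :
    ∃ S : Spanner G f, S.size = 0 := by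
  obtain ⟨S, h⟩ := exists_spanner_of_within (G := G) (H := ⊥) bot_le f (fun x ↦ isEmptyElim x)
  exact ⟨S, by simpa using h⟩

end Size

end GirthCompression

/-! ### The theorem -/

theorem mainTheorem7 :
    ∃ C : ℝ, 0 < C ∧
      ∀ γ : ℕ, 1 ≤ γ →
      ∀ (V : Type u) [Fintype V] (G : SimpleGraph V), ((2 * γ + 1 : ℕ) : ℕ∞) ≤ G.egirth →
        (∃ E : GirthCompression.Emulator G (fun d => (d : ℝ) + 4 * (γ : ℝ)),
          (E.size : ℝ) ≤ C * (Fintype.card V : ℝ) ^ (1 + 1 / (2 * (γ : ℝ) + 1))) ∧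
        (∃ S : GirthCompression.Spanner G (fun d => (d : ℝ) + 6 * (γ : ℝ)),
          (S.size : ℝ) ≤ C * (Fintype.card V : ℝ) ^ (1 + 1 / (2 * (γ : ℝ) + 1))) ∧
        ∀ k : ℕ, 2 ≤ k →
          (∃ E : GirthCompression.Emulator G (fun d =>
              (d : ℝ) + C * (γ : ℝ) * ((k : ℝ) * (d : ℝ) ^ (1 - 1 / (k : ℝ)) + (3 : ℝ) ^ k)),
            (E.size : ℝ) ≤
              C * (k : ℝ) *
                (Fintype.card V : ℝ) ^ (1 + 1 / (((γ : ℝ) + 1) * (2 : ℝ) ^ k - 1))) ∧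
          GirthCompression.hExp γ k < 3 / (2 * ((γ : ℝ) + 1)) ∧
          ∀ ε : ℝ, 0 < ε → ε ≤ 1 →
            ∃ S : GirthCompression.Spanner G (fun d =>
                (1 + ε) * (d : ℝ) + (C * ((γ : ℝ) * (k : ℝ) / ε)) ^ (k - 1)),
              (S.size : ℝ) ≤
                C * ((γ : ℝ) * (k : ℝ) / ε) ^ GirthCompression.hExp γ k * (k : ℝ) *
                  (Fintype.card V : ℝ) ^ (1 + 1 / (((γ : ℝ) + 1) * (2 : ℝ) ^ k - 1)) := by
  refine ⟨12000, by norm_num, fun γ hγ V _ G hG ↦ ?_⟩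
  -- The level sizes are multiples of `n` and must be positive, so the empty graph is treated apart.
  rcases isEmpty_or_nonempty V with hV | hV
  · have hS := GirthCompression.exists_spanner_of_isEmpty G
    have hE := GirthCompression.exists_emulator_of_isEmpty G
    refine ⟨?_, ?_, fun k hk ↦ ⟨?_, ?_, fun ε hε _ ↦ ?_⟩⟩
    · obtain ⟨E, h⟩ := hE _
      exact ⟨E, by rw [h, Nat.cast_zero]; positivity⟩
    · obtain ⟨S, h⟩ := hS _
      exact ⟨S, by rw [h, Nat.cast_zero]; positivity⟩
    · obtain ⟨E, h⟩ := hE _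
      exact ⟨E, by rw [h, Nat.cast_zero]; positivity⟩
    · exact GirthCompression.hExp_lt γ k hγ (by omega)
    · obtain ⟨S, h⟩ := hS _
      exact ⟨S, by rw [h, Nat.cast_zero]; positivity⟩
  have hn : 1 ≤ Fintype.card V := Fintype.card_pos
  refine ⟨?_, ?_, fun k hk ↦ ⟨?_, ?_, fun ε hε hε1 ↦ ?_⟩⟩
  · obtain ⟨E, hE⟩ := GirthCompression.exists_emulator hγ hG 1 le_rfl hn
      (fun d => (d : ℝ) + 4 * (γ : ℝ)) (fun d ↦
        -- A single level: pieces are edges, without error or within `γ` of `A 0`, so one detour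
        -- costs `4 γ`.
        ⟨fun _ ↦ 1, fun _ ↦ 1, fun _ ↦ 0, fun _ ↦ γ,
          ⟨fun i _ hi ↦ absurd hi (by simp), fun i _ hi ↦ absurd hi (by simp),
            fun i _ hi ↦ absurd hi (by simp), fun i _ hi ↦ absurd hi (by simp)⟩,
          rfl, rfl, d, 4 * γ, by simp, by simp, by simp, by push_cast; rfl⟩)
    refine ⟨E, hE.trans ?_⟩
    have hexp : ((γ : ℝ) + 1) * 2 ^ 1 - 1 = 2 * γ + 1 := by ring
    rw [hexp, Nat.cast_one]
    gcongr
    norm_num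
  · obtain ⟨S, hS⟩ := GirthCompression.exists_six_spanner hγ hG hn
    refine ⟨S, hS.trans ?_⟩
    gcongr
    norm_num
  · obtain ⟨E, hE⟩ := GirthCompression.exists_emulator hγ hG k (by omega) hn _
      (fun d ↦ GirthCompression.exists_schedule γ k d hγ (by omega) 12000 (by norm_num))
    refine ⟨E, hE.trans ?_⟩
    gcongr
    norm_num
  · exact GirthCompression.hExp_lt γ k hγ (by omega)
  · obtain ⟨S, hS⟩ := GirthCompression.exists_sublinear_spanner hγ hG k hk hn ε hε hε1 12000
      (by norm_num)
    refine ⟨S, hS.trans ?_⟩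
    gcongr
    norm_num
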